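/- For integers $p\ge 1$ and $q\ge 2$ let $B_{p,q}=\sigma_{q-1}\sigma_{q-2}\cdots\sigma_2\,\sigma_1^{2p-1}$ be the braid on $q$ strands, where $\sigma_i$ is the elementary braid in which the $(i+1)$st strand crosses over the $i$th, all these crossings being positive. Let $L_{p,q}\subset S^3$ be the oriented link that is the union of the closed braid $\hat B_{p,q}$ and its axis $A$, oriented so that $\operatorname{lk}(A,\hat B_{p,q})=+q$. Let $\Delta_{L_{p,q}}(x,t)\in\mathbb{Z}[x^{\pm1},t^{\pm1}]$ denote its multivariable Alexander polynomial, that is, a greatest common divisor of the $(N-1)\times(N-1)$ minors of the Alexander matrix (the Fox Jacobian, evaluated in the abelianization) of the Wirtinger presentation, with $N$ generators, of the link group of a diagram of $L_{p,q}$; it is defined up to multiplication by units $\pm x^at^b$. Here $x$ corresponds to the meridian of $A$ and $t$ to the meridian of $\hat B_{p,q}$. Then $L_{p,q}$ has exactly two components, $A$ and $\hat B_{p,q}$, and, up to units, $$\Delta_{L_{p,2}}(x,t)=1+x\,t^{2p-1},$$ and for $q\ge 3$ $$\Delta_{L_{p,q}}(x,t)=1+x^{q-1}t^{2p+q-3}+x\,t^2\left(\frac{1+t^{2p-3}}{1+t}\right)\left(\frac{1-(xt)^{q-2}}{1-xt}\right),$$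 where the right-hand side, computed in the field of fractions of $\mathbb{Z}[x^{\pm1},t^{\pm1}]$, is an element of $\mathbb{Z}[x^{\pm1},t^{\pm1}]$. -/

import Mathlib

noncomputable section

/-! ### Fox calculus -/

section Fox

variable {ι R : Type} [DecidableEq ι] [CommRing R]

/-- The invertible matrix with rows `(φ i, δ_ij)` and `(0, 1)`. -/
def magnusUnit (φ : ι → Rˣ) (j i : ι) : (Matrix (Fin 2) (Fin 2) R)ˣ where
  val := !![(φ i : R), if i = j then 1 else 0; 0, 1]
  inv := !![((φ i)⁻¹ : Rˣ), if i = j then -(((φ i)⁻¹ : Rˣ) : R) else 0; 0, 1]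
  val_inv := by
    ext a b
    fin_cases a <;> fin_cases b <;> simp [Matrix.mul_apply, Fin.sum_univ_two]
    split_ifs <;> simp
  inv_val := by
    ext a b
    fin_cases a <;> fin_cases b <;> simp [Matrix.mul_apply, Fin.sum_univ_two]
    split_ifs <;> simp

/-- The Fox derivative `∂w/∂x_j` of a word `w` in the free group on the `x_i`, evaluated in a
commutative ring `R` by `x_i ↦ φ i`. It is read off from the (multiplicative) Magnus matrix
with rows `(φ w, ∂w/∂x_j)` and `(0, 1)`; the rules that characterize it are `foxDeriv_one`,
`foxDeriv_of` and `foxDeriv_mul` below. -/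
def foxDeriv (φ : ι → Rˣ) (j : ι) (w : FreeGroup ι) : R :=
  (FreeGroup.lift (magnusUnit φ j) w : Matrix (Fin 2) (Fin 2) R) 0 1

theorem foxDeriv_one (φ : ι → Rˣ) (j : ι) : foxDeriv φ j 1 = 0 := by
  simp [foxDeriv]

theorem foxDeriv_of (φ : ι → Rˣ) (j i : ι) :
    foxDeriv φ j (FreeGroup.of i) = if i = j then 1 else 0 := by
  simp [foxDeriv, magnusUnit]

theorem magnus_shape (φ : ι → Rˣ) (j : ι) (w : FreeGroup ι) :
    (FreeGroup.lift (magnusUnit φ j) w : Matrix (Fin 2) (Fin 2) R) =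
      !![(FreeGroup.lift φ w : R), foxDeriv φ j w; 0, 1] := by
  have key : ((FreeGroup.lift (magnusUnit φ j) w : Matrix (Fin 2) (Fin 2) R) 0 0 =
        (FreeGroup.lift φ w : R)) ∧
      ((FreeGroup.lift (magnusUnit φ j) w : Matrix (Fin 2) (Fin 2) R) 1 0 = 0) ∧
      ((FreeGroup.lift (magnusUnit φ j) w : Matrix (Fin 2) (Fin 2) R) 1 1 = 1) := by
    induction w using FreeGroup.induction_on with
    | C1 => simp
    | of i => simp [magnusUnit]
    | inv_of i _ =>
      simp only [map_inv, FreeGroup.lift_apply_of]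
      refine ⟨?_, ?_, ?_⟩ <;> simp [magnusUnit, ← Units.inv_eq_val_inv]
    | mul u v hu hv =>
      simp [Matrix.mul_apply, Fin.sum_univ_two, hu, hv]
  ext a b
  fin_cases a <;> fin_cases b <;> simp [key, foxDeriv]

theorem foxDeriv_mul (φ : ι → Rˣ) (j : ι) (u v : FreeGroup ι) :
    foxDeriv φ j (u * v) = foxDeriv φ j u + (FreeGroup.lift φ u : R) * foxDeriv φ j v := by
  rw [foxDeriv, map_mul, Units.val_mul, magnus_shape φ j u, magnus_shape φ j v]
  simp [Matrix.mul_apply, Fin.sum_univ_two, add_comm]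

end Fox

/-! ### Oriented link diagrams and their Alexander polynomials -/

/-- An oriented link diagram, recorded by its signed Gauss data: finitely many marked points
(sites) on the link, the successor `next s` of a site along the oriented link, and crossings,
each with its overpass site, its underpass site and its sign. Every passage of a strand through
a crossing is its own site; there may be further sites, away from the crossings.
A diagram in the plane is determined, up to isotopy on the sphere, by such data if it is connected;
the Wirtinger presentation and the Alexander polynomial are read off from them. -/
structure LinkDiagram where
  Site : Type
  [fintypeSite : Fintype Site]
  [decEqSite : DecidableEq Site]
  Crossing : Type
  next : Equiv.Perm Site
  overpass : Crossing → Site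
  underpass : Crossing → Site
  sign : Crossing → ℤˣ
  injective : Function.Injective (Sum.elim overpass underpass)

namespace LinkDiagram

attribute [instance] LinkDiagram.fintypeSite LinkDiagram.decEqSite

variable (D : LinkDiagram)

/-- The components of the link are the cycles of `next`. -/
def Component : Type := Quotient (Equiv.Perm.SameCycle.setoid D.next)

/-- The component on which a site lies. -/
def component (s : D.Site) : D.Component := Quotient.mk _ s

/-- The ring of Laurent polynomials over `ℤ` with one variable for each component: the group
ring of the free abelian group on the components. -/
abbrev LaurentRing : Type := AddMonoidAlgebra ℤ (D.Component →₀ ℤ)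

/-- The variable of a component, as a unit of the ring of Laurent polynomials. -/
def variableUnit (c : D.Component) : D.LaurentRingˣ where
  val := AddMonoidAlgebra.single (Finsupp.single c 1) 1
  inv := AddMonoidAlgebra.single (Finsupp.single c (-1)) 1
  val_inv := by
    rw [AddMonoidAlgebra.single_mul_single, ← Finsupp.single_add]
    simp [AddMonoidAlgebra.one_def]
  inv_val := by
    rw [AddMonoidAlgebra.single_mul_single, ← Finsupp.single_add]
    simp [AddMonoidAlgebra.one_def]

/-- The relators of the Wirtinger presentation of the link group. The generator attached to a
site `s` is the meridian of the segment of the link that leaves `s`. At a crossing of sign `ε`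
with overcrossing meridian `a`, the meridians `b` and `c` of the incoming and of the outgoing
undercrossing segment satisfy `c = a ^ (-ε) * b * a ^ ε`. At a site which is not an underpass
the meridian does not change. -/
def wirtingerRelator :
    D.Crossing ⊕ {s : D.Site // ∀ c, D.underpass c ≠ s} → FreeGroup D.Site
  | .inl c =>
      FreeGroup.of (D.overpass c) ^ (-(D.sign c : ℤ)) * FreeGroup.of (D.next.symm (D.underpass c)) *
        FreeGroup.of (D.overpass c) ^ (D.sign c : ℤ) * (FreeGroup.of (D.underpass c))⁻¹
  | .inr s => FreeGroup.of (D.next.symm s.1) * (FreeGroup.of s.1)⁻¹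

/-- The Alexander matrix: the Fox derivatives of the Wirtinger relators, each meridian being
sent to the variable of its component (abelianization of the link group). -/
def alexanderMatrix :
    Matrix (D.Crossing ⊕ {s : D.Site // ∀ c, D.underpass c ≠ s}) D.Site D.LaurentRing :=
  fun r s => foxDeriv (fun s' => D.variableUnit (D.component s')) s (D.wirtingerRelator r)

/-- `Δ` is a (multivariable) Alexander polynomial of the link: a greatest common divisor of the
`(N - 1) × (N - 1)` minors of the Alexander matrix, where `N` is the number of generators. It
is determined up to multiplication by a unit of the ring of Laurent polynomials. -/
def IsAlexanderPolynomial (Δ : D.LaurentRing) : Prop :=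
  ∀ d : D.LaurentRing, d ∣ Δ ↔
    ∀ (r : Fin (Fintype.card D.Site - 1) → D.Crossing ⊕ {s : D.Site // ∀ c, D.underpass c ≠ s})
      (s : Fin (Fintype.card D.Site - 1) → D.Site),
      d ∣ (D.alexanderMatrix.submatrix r s).det

/-- The field of fractions of the ring of Laurent polynomials (rational functions in the
variables of the components). -/
abbrev RationalFunctions : Type := FractionRing D.LaurentRing

end LinkDiagram

/-! ### Closed braids with their axis -/

/-- A word in the elementary braids on `n` strands. The letter `(i, 1)` is the generator
`σ_(i+1)`, and `(i, -1)` is its inverse, for `i = 0, …, n - 2`. -/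
abbrev BraidWord (n : ℕ) : Type := List (Fin (n - 1) × ℤˣ)

namespace BraidWord

variable {n : ℕ}

/-- The left one of the two adjacent positions on which a generator acts. -/
def left (i : Fin (n - 1)) : Fin n := ⟨i.1, by omega⟩

/-- The right one of the two adjacent positions on which a generator acts. -/
def right (i : Fin (n - 1)) : Fin n := ⟨i.1 + 1, by omega⟩

theorem left_ne_right (i : Fin (n - 1)) : left i ≠ right i := by
  simp [left, right, Fin.ext_iff]

/-- The position in front at a letter: for `σ_(i+1)` the right strand crosses over the left
one; for the inverse the left strand crosses over the right one. -/
def front (l : Fin (n - 1) × ℤˣ) : Fin n := if l.2 = 1 then right l.1 else left l.1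

/-- The position behind at a letter. -/
def back (l : Fin (n - 1) × ℤˣ) : Fin n := if l.2 = 1 then left l.1 else right l.1

theorem front_ne_back (l : Fin (n - 1) × ℤˣ) : front l ≠ back l := by
  unfold front back
  split_ifs
  · exact (left_ne_right _).symm
  · exact left_ne_right _

variable (w : BraidWord n)

/-- The permutation of the positions effected by each layer. Layer `k < w.length` is the `k`-th
letter of the word; in the last two layers the strands run straight past the axis. -/
def layerPerm : Fin (w.length + 2) → Equiv.Perm (Fin n) :=
  Fin.append (fun k : Fin w.length => Equiv.swap (left (w.get k).1) (right (w.get k).1))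
    (fun _ : Fin 2 => 1)

/-- The successor along the closed braid: the strand that enters layer `k` at position `j`
enters the cyclically next layer at position `layerPerm k j`. -/
def strandNext : Equiv.Perm (Fin (w.length + 2) × Fin n) where
  toFun s := (s.1 + 1, w.layerPerm s.1 s.2)
  invFun s := (s.1 - 1, (w.layerPerm (s.1 - 1)).symm s.2)
  left_inv s := by
    ext1 <;> simp
  right_inv s := by
    ext1 <;> simp

/-- The diagram of the link that consists of the closure of a braid on `n` strands and of the
axis of this closed braid.

The strands run downwards, through the layers `0, …, w.length + 1`, and the bottom is joined to
the top position by position; the site `inl (k, j)` is the passage through layer `k` of the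
strand that enters it at position `j`. Layers `0, …, w.length - 1` are the letters of the
word, from top to bottom.

The axis is a circle around the `n` parallel strands. It runs in front of the strands, in layer
`w.length`, from position `n - 1` to position `0`, and returns behind the strands, in layer
`w.length + 1`, from position `0` to position `n - 1`. Its sites, in this order, are the
`inr a` for `a = 0, …, 2 n - 1`.

With this orientation of the strands each `σ_i` is a positive crossing, and so are all
crossings of the axis with the strands: the axis has linking number `+n` with the closed braid. -/
def closureWithAxis : LinkDiagram where
  Site := (Fin (w.length + 2) × Fin n) ⊕ Fin (n + n)
  Crossing := Fin w.length ⊕ (Fin n ⊕ Fin n)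
  next := Equiv.sumCongr w.strandNext (finRotate (n + n))
  overpass
    | .inl k => .inl (Fin.castAdd 2 k, front (w.get k))
    | .inr (.inl j) => .inr (Fin.castAdd n j.rev)
    | .inr (.inr j) => .inl (Fin.natAdd w.length 1, j)
  underpass
    | .inl k => .inl (Fin.castAdd 2 k, back (w.get k))
    | .inr (.inl j) => .inl (Fin.natAdd w.length 0, j)
    | .inr (.inr j) => .inr (Fin.natAdd n j)
  sign
    | .inl k => (w.get k).2
    | .inr _ => 1
  injective := by
    have h := front_ne_back (n := n)
    rintro ((k | j | j) | (k | j | j)) ((k' | j' | j') | (k' | j' | j')) hh <;>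
      simp [Fin.ext_iff] at hh ⊢ <;> first | omega | skip
    · obtain ⟨h1, h2⟩ := hh
      have : k = k' := Fin.ext h1
      subst this
      exact h _ (Fin.ext h2)
    · obtain ⟨h1, h2⟩ := hh
      have : k = k' := Fin.ext h1
      subst this
      exact h _ (Fin.ext h2.symm)

/-- The component formed by the axis. -/
def axisComponent (hn : 0 < n) : w.closureWithAxis.Component :=
  w.closureWithAxis.component (Sum.inr (⟨0, by omega⟩ : Fin (n + n)))

/-- The component of the closed braid that contains the first strand (the whole closed braid if
this is a knot). -/
def braidComponent (hn : 0 < n) : w.closureWithAxis.Component :=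
  w.closureWithAxis.component (Sum.inl ((0 : Fin (w.length + 2)), (⟨0, hn⟩ : Fin n)))

end BraidWord

/-- The braid `B_{p,q} = σ_{q-1} σ_{q-2} ⋯ σ_2 σ_1 ^ (2 p - 1)` on `q` strands. -/
def braidB (p q : ℕ) : BraidWord q :=
  (List.finRange (q - 1)).reverse.flatMap fun i =>
    List.replicate (if i.1 = 0 then 2 * p - 1 else 1) (i, 1)

/-- The link `L_{p,q}`: the closure of `B_{p,q}` together with its axis. -/
def linkL (p q : ℕ) : LinkDiagram := (braidB p q).closureWithAxis

namespace linkL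

/-- The variable `x` of the axis. -/
def x (p q : ℕ) (hq : 2 ≤ q) : (linkL p q).LaurentRing :=
  (linkL p q).variableUnit ((braidB p q).axisComponent (by omega))

/-- The variable `t` of the closed braid. -/
def t (p q : ℕ) (hq : 2 ≤ q) : (linkL p q).LaurentRing :=
  (linkL p q).variableUnit ((braidB p q).braidComponent (by omega))

end linkL

end

/-! The Alexander polynomial of a closed braid with its axis is, up to units and inversion of
variables, the characteristic polynomial of the reduced Burau matrix (Morton's theorem). For the
braids at hand the Burau matrix is close to a companion matrix, so the determinant has a closed
form.

Every site carries exactly one Wirtinger relator, so the Alexander matrix is square and the common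
divisors of its minors are those of the entries of its adjugate (`dvd_minors_iff`). The `n` strand
meridians above the first letter and one axis meridian determine all others, one after another.
Eliminating the others amounts to multiplying by invertible matrices and splitting off an identity
block, which preserves common divisors (`dvd_adjugate_iff_of_elimination`).

What remains is `reducedMatrix`, of size `n + 1`, with main block `x⁻¹ • burau t⁻¹ - 1`
(`dvd_adjugate_iff_reducedMatrix`). It has explicit kernel vectors on both sides: `v` on the right,
with entries `t - 1` and `x - 1`, and `u` on the left, with an entry `1`. Hence the adjugate is the
outer product of `v` and `u` times a scalar `D`. Since `x - 1` and `t - 1` are coprime, the gcd is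
`D`, and one cofactor gives `D` as the determinant of the main block divided by `x - 1`
(`dvd_adjugate_reducedMatrix_iff`).

A second elimination brings this determinant down to size two (`associated_det_burau_braidB`), and a
symmetry under inversion of both variables removes the inverses (`alexanderL_eq_mul_reducedDet`).
There are two components because the braid permutes its positions in a single cycle
(`strandPerm_braidB`). -/

noncomputable section

/-! ### Common divisors of maximal proper minors, and elimination of unknowns -/

section Minors

open Matrix

variable {R : Type} [CommRing R]

theorem exists_eq_succAbove_comp {m : ℕ} {r : Fin m → Fin (m + 1)} (hr : Function.Injective r) :
    ∃ (j : Fin (m + 1)) (σ : Equiv.Perm (Fin m)), r = j.succAbove ∘ σ := by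
  have hns : ¬ Function.Surjective r := fun h => by
    have := Fintype.card_le_of_surjective r h
    simp at this
  obtain ⟨j, hj⟩ := not_forall.1 hns
  have hj' : ∀ i, r i ≠ j := fun i hi => hj ⟨i, hi⟩
  choose τ hτ using fun i => Fin.exists_succAbove_eq (hj' i)
  have hτi : Function.Injective τ := fun a b hab => hr (by rw [← hτ a, ← hτ b, hab])
  exact ⟨j, Equiv.ofBijective τ (Finite.injective_iff_bijective.1 hτi), funext fun i => (hτ i).symm⟩

/-- A selection of rows or columns with a repetition gives a zero minor. Any other selection omits
one index and permutes the rest, so the minor is a cofactor up to sign. -/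
theorem dvd_minors_fin_iff {m : ℕ} (M : Matrix (Fin (m + 1)) (Fin (m + 1)) R) (d : R) :
    (∀ r s : Fin m → Fin (m + 1), d ∣ (M.submatrix r s).det) ↔ ∀ i j, d ∣ M.adjugate i j := by
  constructor
  · intro h i j
    rw [adjugate_fin_succ_eq_det_submatrix]
    exact (h _ _).mul_left _
  · intro h r s
    by_cases hr : Function.Injective r
    · by_cases hs : Function.Injective s
      · obtain ⟨j, σ, rfl⟩ := exists_eq_succAbove_comp hr
        obtain ⟨i, τ, rfl⟩ := exists_eq_succAbove_comp hs
        have h1 : M.submatrix (j.succAbove ∘ σ) (i.succAbove ∘ τ) =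
            ((M.submatrix j.succAbove i.succAbove).submatrix σ id).submatrix id τ := rfl
        rw [h1, det_permute', det_permute]
        have h2 := h i j
        rw [adjugate_fin_succ_eq_det_submatrix] at h2
        have h3 := h2.mul_left ((-1) ^ ((j : ℕ) + i))
        rw [← mul_assoc, ← mul_pow] at h3
        simp only [neg_mul_neg, one_mul, one_pow] at h3
        exact (h3.mul_left _).mul_left _
      · obtain ⟨a, b, hab, hne⟩ : ∃ a b, s a = s b ∧ a ≠ b := by
          simpa [Function.Injective] using hs
        rw [det_zero_of_column_eq hne (fun i => by simp [hab])]
        exact dvd_zero d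
    · obtain ⟨a, b, hab, hne⟩ : ∃ a b, r a = r b ∧ a ≠ b := by
        simpa [Function.Injective] using hr
      rw [det_zero_of_row_eq hne (by ext i; simp [hab])]
      exact dvd_zero d

theorem dvd_minors_iff {ι ρ : Type} [Fintype ι] [DecidableEq ι] [Nonempty ι] (e : ι ≃ ρ)
    (M : Matrix ρ ι R) (d : R) :
    (∀ (r : Fin (Fintype.card ι - 1) → ρ) (s : Fin (Fintype.card ι - 1) → ι),
      d ∣ (M.submatrix r s).det) ↔ ∀ i j, d ∣ (M.submatrix e id).adjugate i j := by
  obtain ⟨m, hm⟩ : ∃ m, Fintype.card ι = m + 1 :=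
    Nat.exists_eq_succ_of_ne_zero Fintype.card_ne_zero
  rw [hm, Nat.add_sub_cancel]
  let g : Fin (m + 1) ≃ ι := (Fintype.equivFinOfCardEq hm).symm
  have key := dvd_minors_fin_iff ((M.submatrix e id).submatrix g g) d
  rw [adjugate_submatrix_equiv_self] at key
  constructor
  · intro h i j
    simpa using key.1 (fun r s => h (e ∘ g ∘ r) (g ∘ s)) (g.symm i) (g.symm j)
  · intro h r s
    have h1 := key.2 (fun i j => h _ _) (g.symm ∘ e.symm ∘ r) (g.symm ∘ s)
    convert h1 using 2
    ext i j
    simp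

/-- The adjugate reverses products, so the entries for `P * A * Q` are combinations of those for
`A`; the inverses of `P` and `Q` give the converse. -/
theorem dvd_adjugate_mul_iff {ι : Type} [Fintype ι] [DecidableEq ι] {P Q A : Matrix ι ι R}
    (hP : IsUnit P.det) (hQ : IsUnit Q.det) (d : R) :
    (∀ i j, d ∣ (P * A * Q).adjugate i j) ↔ ∀ i j, d ∣ A.adjugate i j := by
  have mono : ∀ X Y Z : Matrix ι ι R, (∀ i j, d ∣ Y i j) → ∀ i j, d ∣ (X * Y * Z) i j := by
    intro X Y Z h i j
    simp only [Matrix.mul_apply]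
    exact Finset.dvd_sum fun k _ => (Finset.dvd_sum fun l _ => (h _ _).mul_left _).mul_right _
  constructor
  · intro h i j
    have h1 : A = P⁻¹ * (P * A * Q) * Q⁻¹ := by
      rw [Matrix.mul_assoc P, Matrix.nonsing_inv_mul_cancel_left _ _ hP,
        Matrix.mul_nonsing_inv_cancel_right _ _ hQ]
    rw [h1, adjugate_mul_distrib, adjugate_mul_distrib, ← Matrix.mul_assoc]
    exact mono _ _ _ h i j
  · intro h i j
    rw [adjugate_mul_distrib, adjugate_mul_distrib, ← Matrix.mul_assoc]
    exact mono _ _ _ h i j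

theorem adjugate_fromBlocks_one {m k : Type} [Fintype m] [Fintype k] [DecidableEq m]
    [DecidableEq k] (B : Matrix k k R) :
    (fromBlocks (1 : Matrix m m R) 0 0 B).adjugate = fromBlocks (B.det • 1) 0 0 B.adjugate := by
  ext (i | i) (j | j) <;> rw [adjugate_apply]
  · have h : (fromBlocks (1 : Matrix m m R) 0 0 B).updateRow (.inl j) (Pi.single (.inl i) 1) =
        fromBlocks ((1 : Matrix m m R).updateRow j (Pi.single i 1)) 0 0 B := by
      ext (a | a) (b | b) <;> simp [updateRow_apply, Pi.single_apply]
    rw [h, det_fromBlocks_zero₂₁, ← adjugate_apply, adjugate_one]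
    simp [mul_comm]
  · have h : (fromBlocks (1 : Matrix m m R) 0 0 B).updateRow (.inr j) (Pi.single (.inl i) 1) =
        fromBlocks 1 0 (updateRow 0 j (Pi.single i 1)) (B.updateRow j 0) := by
      ext (a | a) (b | b) <;> simp [updateRow_apply, Pi.single_apply]
    rw [h, det_fromBlocks_zero₁₂, det_eq_zero_of_row_eq_zero (A := B.updateRow j 0) j (by simp)]
    simp
  · have h : (fromBlocks (1 : Matrix m m R) 0 0 B).updateRow (.inl j) (Pi.single (.inr i) 1) =
        fromBlocks ((1 : Matrix m m R).updateRow j 0) (updateRow 0 j (Pi.single i 1)) 0 B := by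
      ext (a | a) (b | b) <;> simp [updateRow_apply, Pi.single_apply]
    rw [h, det_fromBlocks_zero₂₁,
      det_eq_zero_of_row_eq_zero (A := (1 : Matrix m m R).updateRow j 0) j (by simp)]
    simp
  · have h : (fromBlocks (1 : Matrix m m R) 0 0 B).updateRow (.inr j) (Pi.single (.inr i) 1) =
        fromBlocks 1 0 0 (B.updateRow j (Pi.single i 1)) := by
      ext (a | a) (b | b) <;> simp [updateRow_apply, Pi.single_apply]
    rw [h, det_fromBlocks_zero₂₁, ← adjugate_apply]
    simp

theorem dvd_adjugate_fromBlocks_one_iff {m k : Type} [Fintype m] [Fintype k] [DecidableEq m]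
    [DecidableEq k] [Nonempty k] (B : Matrix k k R) (d : R) :
    (∀ i j, d ∣ (fromBlocks (1 : Matrix m m R) 0 0 B).adjugate i j) ↔
      ∀ i j, d ∣ B.adjugate i j := by
  rw [adjugate_fromBlocks_one]
  constructor
  · intro h i j
    simpa using h (.inr i) (.inr j)
  · intro h
    -- The additional nonzero entries equal `B.det`, which expands along a row into entries of
    -- `B.adjugate`. This needs a row, hence `Nonempty k`.
    have hdet : d ∣ B.det := by
      obtain ⟨k₀⟩ := ‹Nonempty k›
      have h1 := congrFun (congrFun (mul_adjugate B) k₀) k₀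
      rw [Matrix.smul_apply, one_apply_eq, smul_eq_mul, mul_one] at h1
      rw [← h1, Matrix.mul_apply]
      exact Finset.dvd_sum fun l _ => (h _ _).mul_left _
    rintro (i | i) (j | j)
    · simpa using hdet.mul_right _
    · simp
    · simp
    · simpa using h i j

/-- Distinct indices of equal rank do not interact, so `rank` need not be injective: each diagonal
block is `-1`. -/
theorem det_isUnit_of_triangular {m : Type} [Fintype m] [DecidableEq m] (T : Matrix m m R)
    (rank : m → ℕ) (hd : ∀ i, T i i = -1) (ht : ∀ i j, i ≠ j → rank i ≤ rank j → T i j = 0) :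
    IsUnit T.det := by
  have hb : T.BlockTriangular (fun i => OrderDual.toDual (rank i)) := fun i j hij =>
    ht i j (by rintro rfl; exact lt_irrefl _ hij) (le_of_lt hij)
  rw [hb.det, IsUnit.prod_iff]
  intro a _
  have : T.toSquareBlock (fun i => OrderDual.toDual (rank i)) a = -1 := by
    ext ⟨i, hi⟩ ⟨j, hj⟩
    by_cases hij : i = j
    · subst hij
      simp [toSquareBlock_def, hd]
    · have := ht i j hij (by rw [← OrderDual.toDual_le_toDual, hi, hj])
      simp [toSquareBlock_def, this, hij]
  rw [this, det_neg, det_one, mul_one]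
  exact (isUnit_one.neg).pow _

/-- Elimination of unknowns: the rows of `A` off the range of `f` express the unknowns off the
range of `f`, one after the other, by those on the range of `f`, with the result `V`. -/
theorem exists_factorization {ι κ : Type} [Fintype ι] [DecidableEq ι] [Fintype κ] [DecidableEq κ]
    (A : Matrix ι ι R) (f : κ → ι) (hf : Function.Injective f) (V : Matrix ι κ R) (rank : ι → ℕ)
    (hV : V.submatrix f id = 1)
    (hd : ∀ i ∉ Set.range f, A i i = -1)
    (ht : ∀ i ∉ Set.range f, ∀ j ∉ Set.range f, i ≠ j → rank i ≤ rank j → A i j = 0)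
    (hAV : ∀ i ∉ Set.range f, (A * V) i = 0) :
    ∃ (m : Type) (_ : Fintype m) (_ : DecidableEq m) (e : m ⊕ κ ≃ ι)
      (P Q : Matrix (m ⊕ κ) (m ⊕ κ) R), IsUnit P.det ∧ IsUnit Q.det ∧
        A.submatrix e e = P * fromBlocks 1 0 0 ((A * V).submatrix f id) * Q := by
  classical
  let m := {i // i ∉ Set.range f}
  let e : m ⊕ κ ≃ ι := ((Equiv.sumComm _ _).trans
    ((Equiv.ofInjective f hf).sumCongr (Equiv.refl m))).trans (Equiv.Set.sumCompl (Set.range f))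
  have e1 : ∀ a : m, e (.inl a) = a.1 := fun a => rfl
  have e2 : ∀ a : κ, e (.inr a) = f a := fun a => rfl
  let T : Matrix m m R := A.submatrix (↑) (↑)
  have hT : IsUnit T.det := det_isUnit_of_triangular T (fun i => rank i) (fun i => hd _ i.2)
    (fun i j hij hr => ht _ i.2 _ j.2 (fun h => hij (Subtype.ext h)) hr)
  let E : Matrix m κ R := V.submatrix (↑) id
  have hsum : ∀ (i : ι) (k : κ), (A * V) i k =
      ∑ a : m, A i a * V a k + A i (f k) := by
    intro i k
    rw [Matrix.mul_apply, ← Equiv.sum_comp e, Fintype.sum_sum_type]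
    congr 1
    have : ∀ a, V (f a) k = (1 : Matrix κ κ R) a k := fun a => by rw [← hV]; rfl
    simp [e2, this, Matrix.one_apply]
  -- `P` contains the triangular block `T` of the eliminated unknowns and `Q` substitutes their
  -- values `E`. The vanishing rows of `A * V` say that the upper right block of `A` is `-T * E`.
  refine ⟨m, inferInstance, inferInstance, e,
    fromBlocks T 0 (A.submatrix f (↑)) 1, fromBlocks 1 (-E) 0 1, ?_, ?_, ?_⟩
  · rw [det_fromBlocks_zero₁₂, det_one, mul_one]
    exact hT
  · rw [det_fromBlocks_zero₂₁, det_one, det_one, mul_one]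
    exact isUnit_one
  · rw [fromBlocks_multiply, fromBlocks_multiply]
    ext (i | i) (j | j)
    · simp [e1, T]
    · have h := hsum i j
      rw [hAV _ i.2] at h
      simp only [Pi.zero_apply] at h
      simp [e1, e2, Matrix.mul_apply, T, E]
      linear_combination -h
    · simp [e1, e2]
    · have h := hsum (f i) j
      simp [e2, Matrix.mul_apply (M := A.submatrix f _), E]
      linear_combination -h

theorem dvd_adjugate_iff_of_elimination {ι κ : Type} [Fintype ι] [DecidableEq ι] [Fintype κ]
    [DecidableEq κ] [Nonempty κ]
    (A : Matrix ι ι R) (f : κ → ι) (hf : Function.Injective f) (V : Matrix ι κ R) (rank : ι → ℕ)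
    (hV : V.submatrix f id = 1)
    (hd : ∀ i ∉ Set.range f, A i i = -1)
    (ht : ∀ i ∉ Set.range f, ∀ j ∉ Set.range f, i ≠ j → rank i ≤ rank j → A i j = 0)
    (hAV : ∀ i ∉ Set.range f, (A * V) i = 0) (d : R) :
    (∀ i j, d ∣ A.adjugate i j) ↔ ∀ i j, d ∣ ((A * V).submatrix f id).adjugate i j := by
  obtain ⟨m, _, _, e, P, Q, hP, hQ, h⟩ := exists_factorization A f hf V rank hV hd ht hAV
  rw [← dvd_adjugate_fromBlocks_one_iff (m := m) ((A * V).submatrix f id), ← dvd_adjugate_mul_iff hP hQ, ← h,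
    adjugate_submatrix_equiv_self]
  exact ⟨fun h i j => h _ _, fun h i j => by simpa using h (e.symm i) (e.symm j)⟩

theorem det_of_elimination {ι κ : Type} [Fintype ι] [DecidableEq ι] [Fintype κ]
    [DecidableEq κ]
    (A : Matrix ι ι R) (f : κ → ι) (hf : Function.Injective f) (V : Matrix ι κ R) (rank : ι → ℕ)
    (hV : V.submatrix f id = 1)
    (hd : ∀ i ∉ Set.range f, A i i = -1)
    (ht : ∀ i ∉ Set.range f, ∀ j ∉ Set.range f, i ≠ j → rank i ≤ rank j → A i j = 0)
    (hAV : ∀ i ∉ Set.range f, (A * V) i = 0) :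
    Associated A.det ((A * V).submatrix f id).det := by
  obtain ⟨m, _, _, e, P, Q, ⟨p, hP⟩, ⟨q, hQ⟩, h⟩ :=
    exists_factorization A f hf V rank hV hd ht hAV
  rw [← det_submatrix_equiv_self e A, h, det_mul, det_mul, det_fromBlocks_zero₂₁, det_one, one_mul,
    ← hP, ← hQ]
  refine ⟨(p * q)⁻¹, ?_⟩
  rw [mul_right_comm (p : R), ← Units.val_mul, mul_right_comm, ← Units.val_mul, mul_inv_cancel,
    Units.val_one, one_mul]

/-- The difference of the two sides is the determinant of `B` with row `r` replaced by `v i • e_j -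
v j • e_i`, and this matrix still kills `v`. -/
theorem mul_adjugate_apply_comm [IsDomain R] {κ : Type} [Fintype κ] [DecidableEq κ]
    (B : Matrix κ κ R) {v : κ → R} (hv : B *ᵥ v = 0) (hv₀ : v ≠ 0) (i j r : κ) :
    v i * B.adjugate j r = v j * B.adjugate i r := by
  rw [adjugate_apply, adjugate_apply, ← det_updateRow_smul, ← det_updateRow_smul,
    ← sub_eq_zero, sub_eq_add_neg, ← neg_one_mul, ← det_updateRow_smul, ← det_updateRow_add]
  apply exists_mulVec_eq_zero_iff.1
  refine ⟨v, hv₀, ?_⟩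
  ext k
  by_cases hk : k = r
  · subst hk
    rw [mulVec, updateRow_self, add_dotProduct, smul_dotProduct, smul_dotProduct, smul_dotProduct,
      single_one_dotProduct, single_one_dotProduct]
    simp [mul_comm]
  · have := congrFun hv k
    simp only [mulVec] at this ⊢
    rw [updateRow_ne hk, this]

/-- The greatest common divisor of the entries of an adjugate of rank one. -/
theorem dvd_adjugate_iff_of_mulVec_eq_zero [IsDomain R] {κ : Type} [Fintype κ] [DecidableEq κ]
    (B : Matrix κ κ R) (u v : κ → R) (hv : B *ᵥ v = 0) (hu : u ᵥ* B = 0) (D : R) (i₀ i₁ r₀ : κ)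
    (hv₀ : v i₀ ≠ 0) (hu₀ : u r₀ = 1) (hD : B.adjugate i₀ r₀ = v i₀ * D)
    (hcop : ∀ a b : R, a ∣ v i₀ * b → a ∣ v i₁ * b → a ∣ b) (d : R) :
    (∀ i j, d ∣ B.adjugate i j) ↔ d ∣ D := by
  have hcol := mul_adjugate_apply_comm B hv fun h => hv₀ (by rw [h]; rfl)
  have hrow : ∀ j r r', u r * B.adjugate j r' = u r' * B.adjugate j r := by
    intro j r r'
    have := mul_adjugate_apply_comm Bᵀ ((mulVec_transpose B u).trans hu)
      (fun h => one_ne_zero (hu₀.symm.trans (by rw [h]; rfl))) r r' j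
    simpa only [← adjugate_transpose, transpose_apply] using this
  have h₀ : ∀ i, B.adjugate i r₀ = v i * D := fun i =>
    mul_left_cancel₀ hv₀ (by rw [hcol i₀ i r₀, hD]; ring)
  -- Columns are proportional to `v` and rows to `u`; the normalization `u r₀ = 1` leaves `D` as the
  -- scalar factor.
  have hall : ∀ i j, B.adjugate i j = v i * D * u j := fun i j => by
    have := hrow i r₀ j
    rw [hu₀, one_mul, h₀] at this
    rw [this, mul_comm]
  constructor
  · intro h
    refine hcop d D ?_ ?_ <;> rw [← h₀] <;> exact h _ _
  · intro h i j
    rw [hall]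
    exact (h.mul_left _).mul_right _

end Minors

/-! ### Fox derivatives of the Wirtinger relators -/

section Fox

variable {ι R : Type} [DecidableEq ι] [CommRing R]

theorem foxDeriv_inv (φ : ι → Rˣ) (j : ι) (u : FreeGroup ι) :
    foxDeriv φ j u⁻¹ = -((FreeGroup.lift φ u)⁻¹ : Rˣ) * foxDeriv φ j u := by
  have h := foxDeriv_mul φ j u⁻¹ u
  rw [inv_mul_cancel, foxDeriv_one, map_inv] at h
  linear_combination -h

theorem foxDeriv_mul_inv (φ : ι → Rˣ) (a b j : ι) :
    foxDeriv φ j (FreeGroup.of a * (FreeGroup.of b)⁻¹) =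
      (if a = j then 1 else 0) - (φ a * (φ b)⁻¹ : Rˣ) * (if b = j then 1 else 0) := by
  rw [foxDeriv_mul, foxDeriv_inv, foxDeriv_of, foxDeriv_of, FreeGroup.lift_apply_of,
    FreeGroup.lift_apply_of, Units.val_mul]
  ring

/-- The two undercrossing meridians have the same image `φ b = φ c`, so the relator maps to `1` and
`c` gets the coefficient `-1` that the elimination needs on the diagonal. -/
theorem foxDeriv_conj (φ : ι → Rˣ) (a b c j : ι) (h : φ b = φ c) :
    foxDeriv φ j ((FreeGroup.of a)⁻¹ * FreeGroup.of b * FreeGroup.of a * (FreeGroup.of c)⁻¹) =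
      ((φ a)⁻¹ : Rˣ) * (φ c - 1) * (if a = j then 1 else 0) +
        ((φ a)⁻¹ : Rˣ) * (if b = j then 1 else 0) - (if c = j then 1 else 0) := by
  have h1 : (((φ a)⁻¹ : Rˣ) : R) * φ a = 1 := by simp
  have h2 : (((φ c)⁻¹ : Rˣ) : R) * φ c = 1 := by simp
  simp only [foxDeriv_mul, foxDeriv_inv, foxDeriv_of, map_mul, map_inv, FreeGroup.lift_apply_of, h,
    Units.val_mul]
  linear_combination (-(φ c : R) * ((φ c)⁻¹ : Rˣ) * (if c = j then 1 else 0)) * h1 -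
    (if c = j then 1 else 0) * h2

end Fox

/-! ### The square Alexander matrix of a diagram and its elimination -/

namespace LinkDiagram

variable (D : LinkDiagram)

/-- The relator at a site. -/
def relatorEquiv : D.Site ≃ D.Crossing ⊕ {s : D.Site // ∀ c, D.underpass c ≠ s} :=
  (Equiv.ofBijective (Sum.elim D.underpass Subtype.val) (by
    constructor
    · rintro (a | a) (b | b) h
      · have := D.injective (a₁ := .inr a) (a₂ := .inr b) h
        simpa using this
      · exact absurd h (b.2 a)
      · exact absurd h.symm (a.2 b)
      · exact congrArg _ (Subtype.ext h)
    · intro s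
      by_cases h : ∃ c, D.underpass c = s
      · exact ⟨.inl h.choose, h.choose_spec⟩
      · exact ⟨.inr ⟨s, not_exists.1 h⟩, rfl⟩)).symm

theorem relatorEquiv_underpass (c : D.Crossing) : D.relatorEquiv (D.underpass c) = .inl c :=
  (Equiv.symm_apply_eq _).2 rfl

theorem relatorEquiv_of_forall_ne (s : D.Site) (h : ∀ c, D.underpass c ≠ s) :
    D.relatorEquiv s = .inr ⟨s, h⟩ :=
  (Equiv.symm_apply_eq _).2 rfl

/-- The Alexander matrix with the relators indexed by the sites. -/
def squareAlexanderMatrix : Matrix D.Site D.Site D.LaurentRing :=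
  D.alexanderMatrix.submatrix D.relatorEquiv id

theorem isAlexanderPolynomial_iff [Nonempty D.Site] (Δ : D.LaurentRing) :
    D.IsAlexanderPolynomial Δ ↔
      ∀ d, d ∣ Δ ↔ ∀ i j, d ∣ D.squareAlexanderMatrix.adjugate i j := by
  refine forall_congr' fun d => ?_
  rw [dvd_minors_iff D.relatorEquiv]
  rfl

theorem component_next_symm (s : D.Site) : D.component (D.next.symm s) = D.component s :=
  Quotient.sound ⟨1, by simp⟩

theorem squareAlexanderMatrix_of_forall_ne (s : D.Site) (h : ∀ c, D.underpass c ≠ s)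
    (s' : D.Site) :
    D.squareAlexanderMatrix s s' =
      (if D.next.symm s = s' then 1 else 0) - (if s = s' then 1 else 0) := by
  rw [squareAlexanderMatrix, Matrix.submatrix_apply, D.relatorEquiv_of_forall_ne s h, id,
    alexanderMatrix, wirtingerRelator, foxDeriv_mul_inv, component_next_symm]
  simp

theorem squareAlexanderMatrix_underpass (c : D.Crossing) (hc : D.sign c = 1) (s' : D.Site) :
    D.squareAlexanderMatrix (D.underpass c) s' =
      ((D.variableUnit (D.component (D.overpass c)))⁻¹ : D.LaurentRingˣ) *
          (D.variableUnit (D.component (D.underpass c)) - 1) *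
          (if D.overpass c = s' then 1 else 0) +
        ((D.variableUnit (D.component (D.overpass c)))⁻¹ : D.LaurentRingˣ) *
          (if D.next.symm (D.underpass c) = s' then 1 else 0) -
        (if D.underpass c = s' then 1 else 0) := by
  rw [squareAlexanderMatrix, Matrix.submatrix_apply, D.relatorEquiv_underpass, id,
    alexanderMatrix, wirtingerRelator, hc]
  simp only [Units.val_one, zpow_neg, zpow_one]
  exact foxDeriv_conj _ _ _ _ _ (by rw [component_next_symm])

end LinkDiagram

namespace LinkDiagram

variable (D : LinkDiagram)

theorem squareAlexanderMatrix_mul_of_forall_ne {κ : Type} (V : Matrix D.Site κ D.LaurentRing)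
    (s : D.Site) (h : ∀ c, D.underpass c ≠ s) (k : κ) :
    (D.squareAlexanderMatrix * V) s k = V (D.next.symm s) k - V s k := by
  simp [Matrix.mul_apply, D.squareAlexanderMatrix_of_forall_ne s h, sub_mul,
    Finset.sum_sub_distrib]

theorem squareAlexanderMatrix_mul_underpass {κ : Type} (V : Matrix D.Site κ D.LaurentRing)
    (c : D.Crossing) (hc : D.sign c = 1) (k : κ) :
    (D.squareAlexanderMatrix * V) (D.underpass c) k =
      ((D.variableUnit (D.component (D.overpass c)))⁻¹ : D.LaurentRingˣ) *
          (D.variableUnit (D.component (D.underpass c)) - 1) * V (D.overpass c) k +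
        ((D.variableUnit (D.component (D.overpass c)))⁻¹ : D.LaurentRingˣ) *
          V (D.next.symm (D.underpass c)) k - V (D.underpass c) k := by
  simp [Matrix.mul_apply, D.squareAlexanderMatrix_underpass c hc, sub_mul, add_mul,
    Finset.sum_sub_distrib, Finset.sum_add_distrib]

/-- A relator determines the meridian leaving its site from the incoming one and, at an underpass,
the overcrossing one. A rank that grows along both dependencies makes the system triangular; sites
in the range of `f` are exempt. -/
theorem dvd_squareAlexanderMatrix_adjugate_iff {κ : Type} [Fintype κ] [DecidableEq κ] [Nonempty κ]
    (hD : ∀ c, D.sign c = 1)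
    (f : κ → D.Site) (hf : Function.Injective f) (V : Matrix D.Site κ D.LaurentRing)
    (rank : D.Site → ℕ) (hV : V.submatrix f id = 1)
    (h₁ : ∀ s ∉ Set.range f, D.next.symm s ∉ Set.range f → rank (D.next.symm s) < rank s)
    (h₂ : ∀ c, D.underpass c ∉ Set.range f → D.overpass c ∉ Set.range f →
      rank (D.overpass c) < rank (D.underpass c))
    (hAV : ∀ s ∉ Set.range f, (D.squareAlexanderMatrix * V) s = 0) (d : D.LaurentRing) :
    (∀ i j, d ∣ D.squareAlexanderMatrix.adjugate i j) ↔
      ∀ i j, d ∣ ((D.squareAlexanderMatrix * V).submatrix f id).adjugate i j := by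
  have off : ∀ s ∉ Set.range f, ∀ s' ∉ Set.range f, rank s ≤ rank s' →
      D.squareAlexanderMatrix s s' = -(if s = s' then 1 else 0) := by
    intro s hs s' hs' hr
    have hp : D.next.symm s ≠ s' := by
      intro h
      exact absurd (h₁ s hs (h ▸ hs')) (by rw [h]; omega)
    by_cases hc : ∃ c, D.underpass c = s
    · obtain ⟨c, rfl⟩ := hc
      have ho : D.overpass c ≠ s' := by
        intro h
        exact absurd (h₂ c hs (h ▸ hs')) (by rw [h]; omega)
      rw [D.squareAlexanderMatrix_underpass c (hD c), if_neg hp, if_neg ho]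
      ring
    · rw [D.squareAlexanderMatrix_of_forall_ne s (not_exists.1 hc), if_neg hp]
      ring
  refine dvd_adjugate_iff_of_elimination _ f hf V rank hV (fun s hs => ?_)
    (fun s hs s' hs' hne hr => ?_) hAV d
  · rw [off s hs s hs le_rfl, if_pos rfl]
  · rw [off s hs s' hs' hr, if_neg hne, neg_zero]

end LinkDiagram

/-! ### Burau matrices, and the order of elimination for a closed braid with axis -/

namespace BraidWord

variable {n : ℕ}

section Burau

variable {R : Type} [CommRing R]

/-- The effect of a positive letter on the rows attached to the positions (Burau representation
with parameter `s`). -/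
def burauStep {κ : Type} (s : R) (W : Matrix (Fin n) κ R) (l : Fin (n - 1) × ℤˣ) :
    Matrix (Fin n) κ R := fun j i =>
  if j = front l then s * W (back l) i + (1 - s) * W (front l) i
  else if j = back l then W (front l) i else W j i

/-- The Burau matrix of a positive braid word. -/
def burau (s : R) (w : BraidWord n) : Matrix (Fin n) (Fin n) R := w.foldl (burauStep s) 1

theorem burau_take_succ (s : R) (w : BraidWord n) (k : Fin w.length) :
    burau s (w.take (k + 1)) = burauStep s (burau s (w.take k)) (w.get k) := by
  rw [List.take_succ_eq_append_getElem k.2, burau, List.foldl_append]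
  rfl

theorem sum_mul_burauStep {κ : Type} (s : R) (a : Fin n → R) (l : Fin (n - 1) × ℤˣ)
    (ha : a (back l) = s * a (front l)) (W : Matrix (Fin n) κ R) (i : κ) :
    ∑ j, a j * burauStep s W l j i = ∑ j, a j * W j i := by
  have hne := front_ne_back l
  rw [← sub_eq_zero, ← Finset.sum_sub_distrib,
    ← Finset.sum_subset (Finset.subset_univ {front l, back l}), Finset.sum_pair hne]
  · simp only [burauStep, if_pos, if_neg hne.symm, ha]
    ring
  · intro j _ hj
    simp only [Finset.mem_insert, Finset.mem_singleton, not_or] at hj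
    simp [burauStep, hj]

theorem front_of_pos {l : Fin (n - 1) × ℤˣ} (hl : l.2 = 1) : front l = right l.1 := if_pos hl

theorem back_of_pos {l : Fin (n - 1) × ℤˣ} (hl : l.2 = 1) : back l = left l.1 := if_pos hl

/-- At every positive letter the weights satisfy `a (back l) = s * a (front l)`, so each step
preserves the weighted sum. This yields the left kernel vector of `reducedMatrix`. -/
theorem sum_mul_burau (s : R) (w : BraidWord n) (hw : ∀ l ∈ w, l.2 = 1) (i : Fin n) :
    ∑ j : Fin n, s ^ (n - j) * burau s w j i = s ^ (n - i) := by
  have key : ∀ (w : BraidWord n) (hw : ∀ l ∈ w, l.2 = 1) (W : Matrix (Fin n) (Fin n) R),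
      ∑ j : Fin n, s ^ (n - j) * w.foldl (burauStep s) W j i =
        ∑ j : Fin n, s ^ (n - j) * W j i := by
    intro w
    induction w with
    | nil => intro _ W; rfl
    | cons l w ih =>
      intro hw W
      rw [List.foldl_cons, ih (fun l hl => hw l (List.mem_cons_of_mem _ hl)),
        sum_mul_burauStep]
      have hl := hw l List.mem_cons_self
      rw [front_of_pos hl, back_of_pos hl, ← pow_succ']
      congr 1
      have := l.1.2
      simp only [left, right]
      omega
  rw [burau, key w hw]
  simp [Matrix.one_apply]

/-- Each step forms combinations with coefficients of sum `1`. This yields the right kernel vector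
of `reducedMatrix`. -/
theorem sum_burau (s : R) (w : BraidWord n) (j : Fin n) : ∑ i, burau s w j i = 1 := by
  have key : ∀ (w : BraidWord n) (W : Matrix (Fin n) (Fin n) R),
      (∀ j, ∑ i, W j i = 1) → ∀ j, ∑ i, w.foldl (burauStep s) W j i = 1 := by
    intro w
    induction w with
    | nil => intro W hW; exact hW
    | cons l w ih =>
      intro W hW
      refine ih _ fun j => ?_
      simp only [burauStep]
      split_ifs
      · rw [Finset.sum_add_distrib, ← Finset.mul_sum, ← Finset.mul_sum, hW, hW]
        ring
      · exact hW _
      · exact hW _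
  exact key w 1 (fun j => by simp [Matrix.one_apply]) j

end Burau

variable (w : BraidWord n)

theorem swap_front (l : Fin (n - 1) × ℤˣ) :
    Equiv.swap (left l.1) (right l.1) (front l) = back l := by
  unfold front back
  split_ifs <;> simp

theorem swap_back (l : Fin (n - 1) × ℤˣ) :
    Equiv.swap (left l.1) (right l.1) (back l) = front l := by
  unfold front back
  split_ifs <;> simp

theorem swap_of_ne (l : Fin (n - 1) × ℤˣ) {j : Fin n} (hf : j ≠ front l) (hb : j ≠ back l) :
    Equiv.swap (left l.1) (right l.1) j = j := by
  unfold front at hf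
  unfold back at hb
  apply Equiv.swap_apply_of_ne_of_ne <;> split_ifs at hf hb <;> assumption

theorem layerPerm_castAdd (k : Fin w.length) :
    w.layerPerm (Fin.castAdd 2 k) = Equiv.swap (left (w.get k).1) (right (w.get k).1) :=
  Fin.append_left _ _ _

theorem layerPerm_natAdd (k : Fin 2) : w.layerPerm (Fin.natAdd w.length k) = 1 :=
  Fin.append_right _ _ _

/-- The passage through layer `k` of the strand that enters it at position `j`. -/
def strandSite (k : Fin (w.length + 2)) (j : Fin n) : w.closureWithAxis.Site := .inl (k, j)

/-- The sites of the axis. -/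
def axisSite (a : Fin (n + n)) : w.closureWithAxis.Site := .inr a

theorem forall_site {P : w.closureWithAxis.Site → Prop} :
    (∀ s, P s) ↔ (∀ k j, P (w.strandSite k j)) ∧ ∀ a, P (w.axisSite a) :=
  ⟨fun h => ⟨fun _ _ => h _, fun _ => h _⟩, fun h s =>
    match s with
    | .inl (k, j) => h.1 k j
    | .inr a => h.2 a⟩

/-- Unknowns in terms of which all meridians of a closed braid with axis are expressed: the
strands before the first letter, and the axis in front of the strands. -/
def basicSite (hn : 0 < n) : Fin n ⊕ Unit → w.closureWithAxis.Site
  | .inl j => w.strandSite (Fin.natAdd w.length 1) j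
  | .inr _ => w.axisSite ⟨n + n - 1, by omega⟩

theorem basicSite_injective (hn : 0 < n) : Function.Injective (w.basicSite hn) := by
  rintro (a | a) (b | b) h
  · have : a = b := congrArg Prod.snd (Sum.inl_injective h)
    simp [this]
  · cases h
  · cases h
  · rfl

theorem strandSite_mem_range_basicSite (hn : 0 < n) (k : Fin (w.length + 2)) (j : Fin n) :
    w.strandSite k j ∈ Set.range (w.basicSite hn) ↔ k = Fin.natAdd w.length 1 := by
  constructor
  · rintro ⟨a | a, h⟩
    · exact (congrArg Prod.fst (Sum.inl_injective h)).symm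
    · cases h
  · rintro rfl
    exact ⟨.inl j, rfl⟩

theorem axisSite_mem_range_basicSite (hn : 0 < n) (a : Fin (n + n)) :
    w.axisSite a ∈ Set.range (w.basicSite hn) ↔ a.1 = n + n - 1 := by
  constructor
  · rintro ⟨b | b, h⟩
    · cases h
    · rw [← Sum.inr_injective h]
  · intro h
    exact ⟨.inr (), congrArg Sum.inr (Fin.ext h.symm)⟩

theorem next_symm_strandSite_zero (j : Fin n) :
    w.closureWithAxis.next.symm (w.strandSite 0 j) = w.strandSite (Fin.natAdd w.length 1) j := by
  rw [Equiv.symm_apply_eq]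
  refine congrArg Sum.inl (Prod.ext ?_ ?_)
  · ext
    simp [strandNext, Fin.val_add]
  · simp [strandNext, layerPerm_natAdd]

theorem next_symm_strandSite_succ (k : ℕ) (hk : k + 1 < w.length + 2) (j : Fin n) :
    w.closureWithAxis.next.symm (w.strandSite ⟨k + 1, hk⟩ j) =
      w.strandSite ⟨k, by omega⟩ ((w.layerPerm ⟨k, by omega⟩).symm j) := by
  rw [Equiv.symm_apply_eq]
  refine congrArg Sum.inl (Prod.ext ?_ ?_)
  · ext
    simp only [strandNext, Equiv.coe_fn_mk, Fin.val_add]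
    exact (Nat.mod_eq_of_lt hk).symm
  · simp [strandNext]

theorem finRotate_mk_pred {N : ℕ} (h : 0 < N) :
    finRotate N ⟨N - 1, by omega⟩ = ⟨0, h⟩ := by
  obtain _ | m := N
  · omega
  · exact finRotate_last' (n := m)

theorem finRotate_mk_of_lt {N a : ℕ} (h : a + 1 < N) :
    finRotate N ⟨a, by omega⟩ = ⟨a + 1, h⟩ := by
  obtain _ | m := N
  · omega
  · exact finRotate_of_lt (n := m) (by omega)

theorem next_symm_axisSite_zero (h : 0 < n + n) :
    w.closureWithAxis.next.symm (w.axisSite ⟨0, h⟩) = w.axisSite ⟨n + n - 1, by omega⟩ := by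
  rw [Equiv.symm_apply_eq]
  exact congrArg Sum.inr (finRotate_mk_pred h).symm

theorem next_symm_axisSite_succ (a : ℕ) (h : a + 1 < n + n) :
    w.closureWithAxis.next.symm (w.axisSite ⟨a + 1, h⟩) = w.axisSite ⟨a, by omega⟩ := by
  rw [Equiv.symm_apply_eq]
  exact congrArg Sum.inr (finRotate_mk_of_lt h).symm

/-- An order in which the meridians of a closed braid with axis are determined. -/
def siteRank : w.closureWithAxis.Site → ℕ
  | .inl (k, j) => 2 * n + 2 * k +
      if ∃ c : Fin w.length, Fin.castAdd 2 c = k ∧ back (w.get c) = j then 1 else 0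
  | .inr a => a

theorem siteRank_strandSite (k : Fin (w.length + 2)) (j : Fin n) :
    w.siteRank (w.strandSite k j) = 2 * n + 2 * k +
      if ∃ c : Fin w.length, Fin.castAdd 2 c = k ∧ back (w.get c) = j then 1 else 0 := rfl

theorem siteRank_axisSite (a : Fin (n + n)) : w.siteRank (w.axisSite a) = a := rfl

theorem siteRank_next_symm (hn : 0 < n) (s : w.closureWithAxis.Site)
    (hs : w.closureWithAxis.next.symm s ∉ Set.range (w.basicSite hn)) :
    w.siteRank (w.closureWithAxis.next.symm s) < w.siteRank s := by
  revert s
  rw [forall_site]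
  constructor
  · rintro ⟨_ | k, hk⟩ j hs
    · exact absurd ((w.strandSite_mem_range_basicSite hn _ j).2 rfl)
        (w.next_symm_strandSite_zero j ▸ hs)
    · rw [next_symm_strandSite_succ, siteRank_strandSite, siteRank_strandSite]
      dsimp only
      split_ifs <;> omega
  · rintro ⟨_ | a, ha⟩ hs
    · exact absurd ((w.axisSite_mem_range_basicSite hn _).2 rfl)
        (w.next_symm_axisSite_zero ha ▸ hs)
    · rw [next_symm_axisSite_succ, siteRank_axisSite, siteRank_axisSite]
      simp

/-- Within a letter the underpass ranks one above the overpass. The axis in front ranks below all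
strands, and where the axis runs behind, the overpasses are basic sites. -/
theorem siteRank_overpass (hn : 0 < n) (c : w.closureWithAxis.Crossing)
    (hc : w.closureWithAxis.overpass c ∉ Set.range (w.basicSite hn)) :
    w.siteRank (w.closureWithAxis.overpass c) < w.siteRank (w.closureWithAxis.underpass c) := by
  obtain k | j | j := c
  · change w.siteRank (w.strandSite (Fin.castAdd 2 k) (front (w.get k))) <
      w.siteRank (w.strandSite (Fin.castAdd 2 k) (back (w.get k)))
    rw [siteRank_strandSite, siteRank_strandSite, if_neg, if_pos ⟨k, rfl, rfl⟩]
    · omega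
    · rintro ⟨c, h, h'⟩
      obtain rfl := Fin.castAdd_injective _ _ h
      exact front_ne_back _ h'.symm
  · change w.siteRank (w.axisSite (Fin.castAdd n j.rev)) <
      w.siteRank (w.strandSite (Fin.natAdd w.length 0) j)
    rw [siteRank_strandSite, siteRank_axisSite, Fin.val_castAdd]
    omega
  · exact absurd ((w.strandSite_mem_range_basicSite hn _ j).2 rfl) hc

end BraidWord

/-! ### Reduction of the Alexander matrix to the Burau matrix -/

namespace BraidWord

variable {n : ℕ} (w : BraidWord n)

section Rows

variable {R : Type} [CommRing R] (x t : Rˣ)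

/-- The Fox differential of the meridian that leaves a site of the braid, in terms of the basic
sites. -/
def strandRow (k : Fin (w.length + 2)) (j : Fin n) : Fin n ⊕ Unit → R :=
  if k.1 < w.length then Sum.elim (burau ((t⁻¹ : Rˣ) : R) (w.take (k + 1)) (w.layerPerm k j)) 0
  else Sum.elim (fun i => ((x⁻¹ : Rˣ) : R) * burau ((t⁻¹ : Rˣ) : R) w j i)
    (fun _ => ((x⁻¹ : Rˣ) : R) * (t - 1))

/-- The Fox differential of the meridian that leaves a site of the axis, in terms of the basic
sites. -/
def axisRow (n : ℕ) (a : ℕ) : Fin n ⊕ Unit → R :=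
  Sum.elim (fun i => if i + n ≤ a then (x - 1) * ((t⁻¹ : Rˣ) : R) ^ (a + 1 - n - i) else 0)
    (fun _ => ((t⁻¹ : Rˣ) : R) ^ (a + 1 - n))

/-- The Fox differentials of all meridians, as far as determined by the preceding ones. -/
def siteRow : w.closureWithAxis.Site → Fin n ⊕ Unit → R
  | .inl (k, j) => w.strandRow x t k j
  | .inr a => axisRow x t n a

/-- The Fox differentials of all meridians in terms of the basic sites. -/
def siteValue : Matrix w.closureWithAxis.Site (Fin n ⊕ Unit) R
  | .inl (k, j) => if k = Fin.natAdd w.length 1 then Pi.single (.inl j) 1 else w.strandRow x t k j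
  | .inr a => if a.1 = n + n - 1 then Pi.single (.inr ()) 1 else axisRow x t n a

theorem siteRow_strandSite (k : Fin (w.length + 2)) (j : Fin n) :
    w.siteRow x t (w.strandSite k j) = w.strandRow x t k j := rfl

theorem siteRow_axisSite (a : Fin (n + n)) :
    w.siteRow x t (w.axisSite a) = axisRow x t n a := rfl

theorem siteValue_strandSite (k : Fin (w.length + 2)) (j : Fin n) :
    w.siteValue x t (w.strandSite k j) =
      if k = Fin.natAdd w.length 1 then Pi.single (.inl j) 1 else w.strandRow x t k j := rfl

theorem siteValue_axisSite (a : Fin (n + n)) :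
    w.siteValue x t (w.axisSite a) =
      if a.1 = n + n - 1 then Pi.single (.inr ()) 1 else axisRow x t n a := rfl

theorem siteValue_of_notMem (hn : 0 < n) (s : w.closureWithAxis.Site)
    (hs : s ∉ Set.range (w.basicSite hn)) : w.siteValue x t s = w.siteRow x t s := by
  revert s
  rw [forall_site]
  constructor
  · intro k j h
    rw [strandSite_mem_range_basicSite] at h
    rw [siteValue_strandSite, if_neg h, siteRow_strandSite]
  · intro a h
    rw [axisSite_mem_range_basicSite] at h
    rw [siteValue_axisSite, if_neg h, siteRow_axisSite]

theorem siteValue_submatrix_basicSite (hn : 0 < n) :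
    (w.siteValue x t).submatrix (w.basicSite hn) id = 1 := by
  ext (j | j) i
  · rw [Matrix.submatrix_apply, basicSite, siteValue_strandSite, if_pos rfl, Matrix.one_apply,
      Pi.single_apply, id]
    simp only [eq_comm]
  · rw [Matrix.submatrix_apply, basicSite, siteValue_axisSite, if_pos rfl, Matrix.one_apply,
      Pi.single_apply, id]
    simp only [eq_comm]

theorem siteValue_next_symm_strandSite (k : ℕ) (hk : k ≤ w.length) (j : Fin n) :
    w.siteValue x t (w.closureWithAxis.next.symm (w.strandSite ⟨k, by omega⟩ j)) =
      Sum.elim (burau ((t⁻¹ : Rˣ) : R) (w.take k) j) 0 := by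
  obtain _ | k := k
  · erw [next_symm_strandSite_zero]
    rw [siteValue_strandSite, if_pos rfl]
    ext (i | i)
    · simp [burau, Matrix.one_apply, Pi.single_apply, eq_comm]
    · simp
  · rw [next_symm_strandSite_succ, siteValue_strandSite, if_neg, strandRow, if_pos (Nat.lt_of_succ_le hk)]
    · simp
    · simp [Fin.ext_iff]
      omega

/-- In front of the strands the axis only passes over, so its meridian is constant: the truncated
exponent `a + 1 - n` is `0` and no `i` satisfies `i + n ≤ a`. -/
theorem siteValue_axisSite_of_lt (a : Fin (n + n)) (ha : a.1 < n) :
    w.siteValue x t (w.axisSite a) = Pi.single (.inr ()) 1 := by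
  rw [siteValue_axisSite]
  split_ifs
  · rfl
  · ext (i | i)
    · simp only [axisRow, Sum.elim_inl]
      rw [if_neg (by omega)]
      simp
    · simp [axisRow, Nat.sub_eq_zero_of_le (Nat.succ_le_of_lt ha)]

theorem siteRow_axisSite_of_lt (a : Fin (n + n)) (ha : a.1 < n) :
    w.siteRow x t (w.axisSite a) = Pi.single (.inr ()) 1 := by
  rw [siteRow_axisSite]
  ext (i | i)
  · simp only [axisRow, Sum.elim_inl]
    rw [if_neg (by omega)]
    simp
  · simp [axisRow, Nat.sub_eq_zero_of_le (Nat.succ_le_of_lt ha)]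

end Rows

theorem ne_underpass_strandSite (k : Fin w.length) (j : Fin n) (hj : j ≠ back (w.get k))
    (c : w.closureWithAxis.Crossing) :
    w.closureWithAxis.underpass c ≠ w.strandSite (Fin.castAdd 2 k) j := by
  obtain c | c | c := c
  · intro h
    have h1 := Sum.inl_injective h
    obtain rfl := Fin.castAdd_injective _ _ (congrArg Prod.fst h1)
    exact hj (congrArg Prod.snd h1).symm
  · intro h
    have h1 := congrArg Fin.val (congrArg Prod.fst (Sum.inl_injective h))
    simp at h1
    omega
  · intro h
    cases h

theorem ne_underpass_last (j : Fin n) (c : w.closureWithAxis.Crossing) :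
    w.closureWithAxis.underpass c ≠ w.strandSite (Fin.natAdd w.length 1) j := by
  obtain c | c | c := c
  · intro h
    have h1 := congrArg Fin.val (congrArg Prod.fst (Sum.inl_injective h))
    simp at h1
    omega
  · intro h
    have h1 := congrArg Fin.val (congrArg Prod.fst (Sum.inl_injective h))
    simp at h1
  · intro h
    cases h

theorem ne_underpass_axisSite (a : Fin (n + n)) (ha : a.1 < n) (c : w.closureWithAxis.Crossing) :
    w.closureWithAxis.underpass c ≠ w.axisSite a := by
  obtain c | c | c := c
  · intro h
    cases h
  · intro h
    cases h
  · intro h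
    have h1 := congrArg Fin.val (Sum.inr_injective h)
    simp at h1
    omega

/-- `siteRow` is what the relator at a site predicts from the preceding values, whereas `siteValue`
has unit vectors at the basic sites. The product thus vanishes off the basic sites and records there
the condition that the link closes up. -/
theorem squareAlexanderMatrix_mul_siteValue {x t : w.closureWithAxis.LaurentRingˣ}
    (hx : ∀ a, w.closureWithAxis.variableUnit (w.closureWithAxis.component (w.axisSite a)) = x)
    (ht : ∀ k j,
      w.closureWithAxis.variableUnit (w.closureWithAxis.component (w.strandSite k j)) = t)
    (hw : ∀ l ∈ w, l.2 = 1)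
    (s : w.closureWithAxis.Site) (i : Fin n ⊕ Unit) :
    (w.closureWithAxis.squareAlexanderMatrix * w.siteValue x t) s i =
      w.siteRow x t s i - w.siteValue x t s i := by
  have hsign : ∀ c, w.closureWithAxis.sign c = 1 := by
    rintro (c | c | c)
    · exact hw _ (w.get_mem c)
    · rfl
    · rfl
  have htt : ((t⁻¹ : w.closureWithAxis.LaurentRingˣ) : w.closureWithAxis.LaurentRing) * t = 1 := by
    simp
  revert s
  rw [forall_site]
  constructor
  · intro k j
    induction k using Fin.addCases with
    | left k =>
      have hk : Fin.castAdd 2 k ≠ Fin.natAdd w.length 1 := by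
        simp only [ne_eq, Fin.ext_iff, Fin.val_castAdd, Fin.val_natAdd]
        omega
      have hprev := w.siteValue_next_symm_strandSite x t k k.2.le j
      by_cases hj : j = back (w.get k)
      · subst hj
        have h := w.closureWithAxis.squareAlexanderMatrix_mul_underpass (w.siteValue x t) (.inl k)
          (hsign _) i
        change _ = ((w.closureWithAxis.variableUnit (w.closureWithAxis.component
          (w.strandSite (Fin.castAdd 2 k) (front (w.get k)))))⁻¹ : _ˣ) *
          (w.closureWithAxis.variableUnit (w.closureWithAxis.component
            (w.strandSite (Fin.castAdd 2 k) (back (w.get k)))) - 1) *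
          (w.siteValue x t (w.strandSite (Fin.castAdd 2 k) (front (w.get k))) i) +
          ((w.closureWithAxis.variableUnit (w.closureWithAxis.component
          (w.strandSite (Fin.castAdd 2 k) (front (w.get k)))))⁻¹ : _ˣ) *
          (w.siteValue x t (w.closureWithAxis.next.symm
            (w.strandSite (Fin.castAdd 2 k) (back (w.get k)))) i) - w.siteValue x t
            (w.strandSite (Fin.castAdd 2 k) (back (w.get k))) i at h
        refine h.trans ?_
        rw [ht, ht, show w.siteValue x t (w.closureWithAxis.next.symm
            (w.strandSite (Fin.castAdd 2 k) (back (w.get k)))) = _ from hprev]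
        rw [siteRow_strandSite, siteValue_strandSite, siteValue_strandSite, if_neg hk, if_neg hk,
          strandRow, strandRow, if_pos (by simp), if_pos (by simp), layerPerm_castAdd, swap_front,
          swap_back, Fin.val_castAdd, burau_take_succ]
        obtain i | i := i
        · simp only [Sum.elim_inl, burauStep, if_neg (front_ne_back _).symm, if_pos]
          -- The Fox coefficient `t⁻¹ * (t - 1)` of the overpass is the Burau coefficient `1 - s` at
          -- `s = t⁻¹`.
          linear_combination (burau ((t⁻¹ : _ˣ) : w.closureWithAxis.LaurentRing) (w.take k)
            (front (w.get k)) i) * htt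
        · simp
      · rw [w.closureWithAxis.squareAlexanderMatrix_mul_of_forall_ne _ _
          (w.ne_underpass_strandSite k j hj)]
        congr 1
        rw [show w.siteValue x t (w.closureWithAxis.next.symm
            (w.strandSite (Fin.castAdd 2 k) j)) = _ from hprev]
        rw [siteRow_strandSite, strandRow, if_pos (by simp), layerPerm_castAdd, Fin.val_castAdd,
          burau_take_succ]
        by_cases hf : j = front (w.get k)
        · subst hf
          rw [swap_front]
          exact congrArg (fun r : Fin n → _ => Sum.elim r (0 : Unit → _) i)
            (funext fun i => by simp only [burauStep, if_neg (front_ne_back _).symm, if_pos])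
        · rw [swap_of_ne _ hf hj]
          exact congrArg (fun r : Fin n → _ => Sum.elim r (0 : Unit → _) i)
            (funext fun i => by simp only [burauStep, if_neg hf, if_neg hj])
    | right k =>
      fin_cases k
      · have hk : Fin.natAdd w.length (0 : Fin 2) ≠ Fin.natAdd w.length 1 := by simp [Fin.ext_iff]
        have hprev := w.siteValue_next_symm_strandSite x t w.length le_rfl j
        rw [List.take_length] at hprev
        have h := w.closureWithAxis.squareAlexanderMatrix_mul_underpass (w.siteValue x t)
          (.inr (.inl j)) (hsign _) i
        change _ = ((w.closureWithAxis.variableUnit (w.closureWithAxis.component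
          (w.axisSite (Fin.castAdd n j.rev))))⁻¹ : _ˣ) *
          (w.closureWithAxis.variableUnit (w.closureWithAxis.component
            (w.strandSite (Fin.natAdd w.length 0) j)) - 1) *
          (w.siteValue x t (w.axisSite (Fin.castAdd n j.rev)) i) +
          ((w.closureWithAxis.variableUnit (w.closureWithAxis.component
          (w.axisSite (Fin.castAdd n j.rev))))⁻¹ : _ˣ) *
          (w.siteValue x t (w.closureWithAxis.next.symm
            (w.strandSite (Fin.natAdd w.length 0) j)) i) - w.siteValue x t
            (w.strandSite (Fin.natAdd w.length 0) j) i at h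
        refine h.trans ?_
        congr 1
        rw [hx, ht, show w.siteValue x t (w.closureWithAxis.next.symm
            (w.strandSite (Fin.natAdd w.length 0) j)) = _ from hprev,
          w.siteValue_axisSite_of_lt x t _ (by simp [Fin.val_castAdd, -Fin.val_rev])]
        simp only [Fin.zero_eta]
        rw [siteRow_strandSite, strandRow, if_neg (by simp)]
        obtain i | i := i
        · simp
        · simp
      · simp only [Fin.mk_one]
        rw [w.closureWithAxis.squareAlexanderMatrix_mul_of_forall_ne _ _ (w.ne_underpass_last j)]
        congr 1
        erw [next_symm_strandSite_succ]
        rw [siteValue_strandSite, if_neg (by simp [Fin.ext_iff]), siteRow_strandSite, strandRow,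
          strandRow, if_neg (by simp), if_neg (by simp)]
        erw [w.layerPerm_natAdd 0]
        rfl
  · intro a
    by_cases ha : a.1 < n
    · rw [w.closureWithAxis.squareAlexanderMatrix_mul_of_forall_ne _ _
        (w.ne_underpass_axisSite a ha), siteRow_axisSite_of_lt _ _ _ _ ha]
      congr 1
      obtain ⟨_ | a, h⟩ := a
      · rw [next_symm_axisSite_zero, siteValue_axisSite, if_pos rfl]
      · rw [next_symm_axisSite_succ, siteValue_axisSite_of_lt _ _ _ _ (Nat.lt_of_succ_lt ha)]
    · obtain ⟨j, rfl⟩ : ∃ j : Fin n, a = Fin.natAdd n j :=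
        ⟨⟨a - n, by omega⟩, by ext; simp; omega⟩
      have h := w.closureWithAxis.squareAlexanderMatrix_mul_underpass (w.siteValue x t)
        (.inr (.inr j)) (hsign _) i
      change _ = ((w.closureWithAxis.variableUnit (w.closureWithAxis.component
        (w.strandSite (Fin.natAdd w.length 1) j)))⁻¹ : _ˣ) *
        (w.closureWithAxis.variableUnit (w.closureWithAxis.component
          (w.axisSite (Fin.natAdd n j))) - 1) *
        (w.siteValue x t (w.strandSite (Fin.natAdd w.length 1) j) i) +
        ((w.closureWithAxis.variableUnit (w.closureWithAxis.component
        (w.strandSite (Fin.natAdd w.length 1) j)))⁻¹ : _ˣ) *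
        (w.siteValue x t (w.closureWithAxis.next.symm (w.axisSite (Fin.natAdd n j))) i) -
        w.siteValue x t (w.axisSite (Fin.natAdd n j)) i at h
      refine h.trans ?_
      congr 1
      have hprev : w.siteValue x t (w.closureWithAxis.next.symm (w.axisSite (Fin.natAdd n j))) =
          axisRow x t n (n + j - 1) := by
        have h1 : w.axisSite (Fin.natAdd n j) = w.axisSite ⟨(n + j - 1) + 1, by omega⟩ :=
          congrArg _ (Fin.ext (by simp; omega))
        rw [h1, next_symm_axisSite_succ, siteValue_axisSite, if_neg (by simp; omega)]
      rw [hx, ht, hprev, siteValue_strandSite, if_pos rfl, siteRow_axisSite, Fin.val_natAdd]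
      obtain i | i := i
      · simp only [axisRow, Sum.elim_inl, Pi.single_apply, Sum.inl.injEq]
        by_cases hij : i = j
        · subst hij
          rw [if_pos rfl, if_neg (by omega), if_pos (by omega),
            show n + (i : ℕ) + 1 - n - i = 1 by omega]
          ring
        · have hij' : i.1 ≠ j.1 := fun h => hij (Fin.ext h)
          rw [if_neg hij]
          by_cases hlt : i.1 < j.1
          · rw [if_pos (by omega), if_pos (by omega),
              show n + (j : ℕ) + 1 - n - i = (n + j - 1 + 1 - n - i) + 1 by omega]
            ring
          · rw [if_neg (by omega), if_neg (by omega)]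
            ring
      · simp only [axisRow, Sum.elim_inr, Pi.single_apply, reduceCtorEq, if_false]
        rw [show n + (j : ℕ) + 1 - n = (n + j - 1 + 1 - n) + 1 by omega]
        ring

/-- The Alexander matrix of a closed braid with axis, reduced to the basic sites. -/
def reducedMatrix {R : Type} [CommRing R] (x t : Rˣ) (w : BraidWord n) :
    Matrix (Fin n ⊕ Unit) (Fin n ⊕ Unit) R :=
  Matrix.fromBlocks (((x⁻¹ : Rˣ) : R) • burau ((t⁻¹ : Rˣ) : R) w - 1)
    (Matrix.of fun _ _ => ((x⁻¹ : Rˣ) : R) * (t - 1))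
    (Matrix.of fun _ i => (x - 1) * ((t⁻¹ : Rˣ) : R) ^ (n - i))
    (Matrix.of fun _ _ => ((t⁻¹ : Rˣ) : R) ^ n - 1)

theorem dvd_adjugate_iff_reducedMatrix {x t : w.closureWithAxis.LaurentRingˣ}
    (hx : ∀ a, w.closureWithAxis.variableUnit (w.closureWithAxis.component (w.axisSite a)) = x)
    (ht : ∀ k j,
      w.closureWithAxis.variableUnit (w.closureWithAxis.component (w.strandSite k j)) = t)
    (hn : 0 < n) (hw : ∀ l ∈ w, l.2 = 1) (d : w.closureWithAxis.LaurentRing) :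
    (∀ i j, d ∣ w.closureWithAxis.squareAlexanderMatrix.adjugate i j) ↔
      ∀ i j, d ∣ (reducedMatrix x t w).adjugate i j := by
  have hB : (w.closureWithAxis.squareAlexanderMatrix * w.siteValue x t).submatrix
      (w.basicSite hn) id = reducedMatrix x t w := by
    have h1 : ∀ b i, w.siteValue x t (w.basicSite hn b) i =
        (1 : Matrix (Fin n ⊕ Unit) (Fin n ⊕ Unit) w.closureWithAxis.LaurentRing) b i :=
      fun b i => by rw [← w.siteValue_submatrix_basicSite x t hn]; rfl
    refine Matrix.ext fun b i => ?_
    rw [Matrix.submatrix_apply, id, squareAlexanderMatrix_mul_siteValue w hx ht hw, h1,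
      ← Matrix.fromBlocks_one]
    obtain b | b := b
    · rw [basicSite, siteRow_strandSite, strandRow, if_neg (by simp)]
      obtain i | i := i <;> simp [reducedMatrix]
    · rw [basicSite, siteRow_axisSite]
      obtain i | i := i
      · simp only [axisRow, reducedMatrix, Sum.elim_inl, Matrix.fromBlocks_apply₂₁,
          Matrix.of_apply, Matrix.zero_apply, sub_zero]
        rw [if_pos (by omega), show n + n - 1 + 1 - n - (i : ℕ) = n - i by omega]
      · simp only [axisRow, reducedMatrix, Sum.elim_inr, Matrix.fromBlocks_apply₂₂,
          Matrix.of_apply, Matrix.one_apply_eq]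
        rw [show n + n - 1 + 1 - n = n by omega]
  have hsign : ∀ c, w.closureWithAxis.sign c = 1 := by
    rintro (c | c | c)
    · exact hw _ (w.get_mem c)
    · rfl
    · rfl
  rw [← hB]
  refine w.closureWithAxis.dvd_squareAlexanderMatrix_adjugate_iff hsign (w.basicSite hn)
    (w.basicSite_injective hn) _ w.siteRank (w.siteValue_submatrix_basicSite x t hn)
    (fun s _ h => w.siteRank_next_symm hn s h) (fun c _ h => w.siteRank_overpass hn c h)
    (fun s hs => ?_) d
  funext i
  rw [squareAlexanderMatrix_mul_siteValue w hx ht hw, siteValue_of_notMem w x t hn s hs, sub_self]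
  rfl

/-- The right kernel vector is Fox's fundamental formula: each meridian minus `1`. The left one
comes from the invariant weights of the Burau matrix. Deleting the row and column of the axis leaves
the block in `hD`; `hcop` expresses coprimality without a gcd. -/
theorem dvd_adjugate_reducedMatrix_iff {R : Type} [CommRing R] [IsDomain R] (x t : Rˣ)
    (hn : 0 < n) (hw : ∀ l ∈ w, l.2 = 1) (hx₁ : (x : R) - 1 ≠ 0)
    (hcop : ∀ a b : R, a ∣ (x - 1) * b → a ∣ (t - 1) * b → a ∣ b) (D : R)
    (hD : (((x⁻¹ : Rˣ) : R) • burau ((t⁻¹ : Rˣ) : R) w - 1).det = (x - 1) * D) (d : R) :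
    (∀ i j, d ∣ (reducedMatrix x t w).adjugate i j) ↔ d ∣ D := by
  have hxx : ((x⁻¹ : Rˣ) : R) * x = 1 := by simp
  have htt : ((t⁻¹ : Rˣ) : R) * t = 1 := by simp
  have hgeom : ((t : R) - 1) * ∑ i : Fin n, ((t⁻¹ : Rˣ) : R) ^ (n - (i : ℕ)) =
      1 - ((t⁻¹ : Rˣ) : R) ^ n := by
    rw [Fin.sum_univ_eq_sum_range (fun i => ((t⁻¹ : Rˣ) : R) ^ (n - i)) n]
    generalize n = N
    induction N with
    | zero => simp
    | succ m ih =>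
      rw [Finset.sum_range_succ', mul_add, Nat.sub_zero]
      simp only [Nat.add_sub_add_right]
      rw [ih, pow_succ]
      linear_combination (((t⁻¹ : Rˣ) : R) ^ m) * htt
  refine dvd_adjugate_iff_of_mulVec_eq_zero (reducedMatrix x t w)
    (Sum.elim (fun i => x * ((t⁻¹ : Rˣ) : R) ^ (n - (i : ℕ))) (fun _ => 1))
    (Sum.elim (fun _ => (t : R) - 1) (fun _ => (x : R) - 1)) ?_ ?_ D (.inr ()) (.inl ⟨0, hn⟩)
    (.inr ()) hx₁ rfl ?_ hcop d
  · ext (j | j)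
    · simp only [Matrix.mulVec, dotProduct, Fintype.sum_sum_type, Sum.elim_inl, Sum.elim_inr,
        reducedMatrix, Matrix.fromBlocks_apply₁₁, Matrix.fromBlocks_apply₁₂, Matrix.of_apply, ← Finset.sum_mul,
        Matrix.sub_apply, Matrix.smul_apply, smul_eq_mul, Finset.sum_sub_distrib, ← Finset.mul_sum,
        sum_burau]
      simp [Matrix.one_apply]
      linear_combination ((t : R) - 1) * hxx
    · simp only [Matrix.mulVec, dotProduct, Fintype.sum_sum_type, Sum.elim_inl, Sum.elim_inr,
        reducedMatrix, Matrix.fromBlocks_apply₂₁, Matrix.fromBlocks_apply₂₂, Matrix.of_apply, ← Finset.sum_mul,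
        ← Finset.mul_sum]
      simp
      linear_combination ((x : R) - 1) * hgeom
  · ext (i | i)
    · simp only [Matrix.vecMul, dotProduct, Fintype.sum_sum_type, Sum.elim_inl, Sum.elim_inr,
        reducedMatrix, Matrix.fromBlocks_apply₁₁, Matrix.fromBlocks_apply₂₁, Matrix.of_apply,
        Matrix.sub_apply, Matrix.smul_apply, smul_eq_mul, mul_sub, Finset.sum_sub_distrib]
      have h := sum_mul_burau ((t⁻¹ : Rˣ) : R) w hw i
      have h1 : ∀ j : Fin n, x * ((t⁻¹ : Rˣ) : R) ^ (n - (j : ℕ)) *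
          (((x⁻¹ : Rˣ) : R) * burau ((t⁻¹ : Rˣ) : R) w j i) =
          ((t⁻¹ : Rˣ) : R) ^ (n - (j : ℕ)) * burau ((t⁻¹ : Rˣ) : R) w j i := fun j => by
        linear_combination (((t⁻¹ : Rˣ) : R) ^ (n - (j : ℕ)) * burau ((t⁻¹ : Rˣ) : R) w j i) * hxx
      simp only [h1, h]
      simp [Matrix.one_apply]
      ring
    · simp only [Matrix.vecMul, dotProduct, Fintype.sum_sum_type, Sum.elim_inl, Sum.elim_inr,
        reducedMatrix, Matrix.fromBlocks_apply₁₂, Matrix.fromBlocks_apply₂₂, Matrix.of_apply, ← Finset.sum_mul,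
        ← Finset.mul_sum]
      simp
      linear_combination hgeom + ((t : R) - 1) *
        (∑ i : Fin n, ((t⁻¹ : Rˣ) : R) ^ (n - (i : ℕ))) * hxx
  · rw [Matrix.adjugate_apply]
    have h : (reducedMatrix x t w).updateRow (.inr ()) (Pi.single (.inr ()) 1) =
        Matrix.fromBlocks (((x⁻¹ : Rˣ) : R) • burau ((t⁻¹ : Rˣ) : R) w - 1)
          (Matrix.of fun _ _ => ((x⁻¹ : Rˣ) : R) * (t - 1)) 0 1 := by
      ext (a | a) (b | b) <;> simp [reducedMatrix, Matrix.updateRow_apply]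
    rw [h, Matrix.det_fromBlocks_zero₂₁, Matrix.det_one, mul_one, hD]
    rfl

end BraidWord

/-! ### The Burau matrix of `braidB` and its determinant -/

theorem braidB_eq (m p : ℕ) :
    braidB p (m + 2) = ((List.finRange m).reverse.map fun i => ((i.succ : Fin (m + 1)), (1 : ℤˣ))) ++
      List.replicate (2 * p - 1) ((0 : Fin (m + 1)), (1 : ℤˣ)) := by
  rw [braidB]
  simp only [Nat.add_one_sub_one]
  rw [List.finRange_succ, List.reverse_cons, List.flatMap_append, ← List.map_reverse,
    List.flatMap_map]
  congr 1
  · rw [List.map_eq_flatMap]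
    rfl
  · simp

theorem snd_of_mem_braidB {p q : ℕ} {l : Fin (q - 1) × ℤˣ} (hl : l ∈ braidB p q) : l.2 = 1 := by
  obtain ⟨i, -, hi⟩ := List.mem_flatMap.1 hl
  rw [List.eq_of_mem_replicate hi]

namespace BraidWord

variable {R : Type} [CommRing R]

theorem burau_append_singleton {n : ℕ} (s : R) (w : BraidWord n) (l : Fin (n - 1) × ℤˣ) :
    burau s (w ++ [l]) = burauStep s (burau s w) l := by
  rw [burau, List.foldl_append]
  rfl

theorem drop_finRange {m c : ℕ} (hc : c < m) :
    (List.finRange m).drop c = ⟨c, hc⟩ :: (List.finRange m).drop (c + 1) := by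
  rw [List.drop_eq_getElem_cons (by simpa using hc), List.getElem_finRange]
  rfl

/-- The Burau matrix of `σ_(m+1) ⋯ σ_(c+2)` on `m + 2` strands. -/
theorem burau_descending (s : R) (m c : ℕ) (hc : c ≤ m) (j i : Fin (m + 2)) :
    burau (n := m + 2) s (((List.finRange m).drop c).reverse.map fun i => (i.succ, 1)) j i =
      if j.1 ≤ c then (if i = j then 1 else 0)
      else if j.1 = c + 1 then (if i.1 = m + 1 then 1 else 0)
      else s * (if i.1 + 1 = j then 1 else 0) + (1 - s) * (if i.1 = m + 1 then 1 else 0) := by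
  -- Lowering `c` appends one letter at the end of the word, where `burau` takes its next step.
  induction hc using Nat.decreasingInduction generalizing j i with
  | self =>
    rw [List.drop_eq_nil_of_le (by simp)]
    have : burau (n := m + 2) s ([] : BraidWord (m + 2)) = 1 := rfl
    simp only [List.reverse_nil, List.map_nil]
    rw [this, Matrix.one_apply]
    simp only [Fin.ext_iff]
    split_ifs <;> first | rfl | omega
  | of_succ c hc ih =>
    rw [drop_finRange hc, List.reverse_cons, List.map_append, List.map_singleton,
      burau_append_singleton]
    simp only [burauStep, ih, front_of_pos, back_of_pos, left, right, Fin.val_succ, Fin.ext_iff]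
    split_ifs <;> first | omega | ring

/-- An entry of the Burau matrix of `σ_1 ^ (2 r + 1)`. -/
def twistCoeff (s : R) (r : ℕ) : R := s * (1 - s) * ∑ i ∈ Finset.range r, s ^ (2 * i)

theorem twistCoeff_succ (s : R) (r : ℕ) :
    twistCoeff s (r + 1) = twistCoeff s r + (1 - s) * s ^ (2 * r + 1) := by
  rw [twistCoeff, Finset.sum_range_succ, twistCoeff]
  ring

/-- Source of the quotient by `1 + t` in the formula: `s - twistCoeff s r` is an alternating sum
that telescopes under multiplication by `1 + s`. -/
theorem one_add_mul_sub_twistCoeff (s : R) (r : ℕ) :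
    (1 + s) * (s - twistCoeff s r) = s ^ 2 + s ^ (2 * r + 1) := by
  induction r with
  | zero => simp [twistCoeff]; ring
  | succ r ih =>
    rw [twistCoeff_succ]
    linear_combination ih

theorem foldl_burauStep_replicate {κ : Type} (s : R) (m r : ℕ) (W : Matrix (Fin (m + 2)) κ R)
    (j : Fin (m + 2)) (i : κ) :
    (List.replicate (2 * r + 1) ((0 : Fin (m + 1)), (1 : ℤˣ))).foldl
        (burauStep (n := m + 2) s) W j i =
      if j.1 = 0 then twistCoeff s r * W 0 i + (1 - twistCoeff s r) * W 1 i
      else if j.1 = 1 then (twistCoeff s r + s ^ (2 * r + 1)) * W 0 i +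
        (1 - twistCoeff s r - s ^ (2 * r + 1)) * W 1 i
      else W j i := by
  have step : ∀ (W : Matrix (Fin (m + 2)) κ R) (j : Fin (m + 2)) (i : κ),
      burauStep (n := m + 2) s W ((0 : Fin (m + 1)), (1 : ℤˣ)) j i =
        if j.1 = 0 then W 1 i else if j.1 = 1 then s * W 0 i + (1 - s) * W 1 i else W j i := by
    intro W j i
    have h0 : back (n := m + 2) ((0 : Fin (m + 1)), (1 : ℤˣ)) = 0 := rfl
    have h1 : front (n := m + 2) ((0 : Fin (m + 1)), (1 : ℤˣ)) = 1 := rfl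
    simp only [burauStep, h0, h1, Fin.ext_iff, Fin.val_zero, Fin.val_one]
    split_ifs <;> first | rfl | omega
  induction r generalizing j i with
  | zero => simp [step, twistCoeff]
  | succ r ih =>
    rw [show 2 * (r + 1) + 1 = 2 * r + 1 + 1 + 1 by ring, List.replicate_succ',
      List.foldl_append, List.replicate_succ', List.foldl_append]
    simp only [List.foldl_cons, List.foldl_nil, step, ih, twistCoeff_succ, Fin.val_zero,
      Fin.val_one]
    split_ifs <;> first | contradiction | omega | ring

theorem burau_braidB (s : R) (m r : ℕ) (j i : Fin (m + 2)) :
    burau s (braidB (r + 1) (m + 2)) j i =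
      if j.1 = 0 then twistCoeff s r * (if i.1 = 0 then 1 else 0) +
        (1 - twistCoeff s r) * (if i.1 = m + 1 then 1 else 0)
      else if j.1 = 1 then (twistCoeff s r + s ^ (2 * r + 1)) * (if i.1 = 0 then 1 else 0) +
        (1 - twistCoeff s r - s ^ (2 * r + 1)) * (if i.1 = m + 1 then 1 else 0)
      else s * (if i.1 + 1 = j then 1 else 0) + (1 - s) * (if i.1 = m + 1 then 1 else 0) := by
  have h := burau_descending s m 0 (Nat.zero_le m)
  rw [List.drop_zero] at h
  rw [braidB_eq, burau, List.foldl_append, show 2 * (r + 1) - 1 = 2 * r + 1 by omega]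
  erw [foldl_burauStep_replicate]
  simp only [burau] at h
  simp only [h, Fin.ext_iff, Fin.val_zero, Fin.val_one]
  split_ifs <;> first | omega | rfl

/-- The value, up to sign, of the characteristic polynomial of the reduced Burau matrix of
`braidB (r + 1) (m + 2)`. -/
def reducedDet (y s : R) (m r : ℕ) : R :=
  (y * twistCoeff s r - 1) * (1 + y * s * ∑ i ∈ Finset.range m, (y * s) ^ i) -
    (y * s) ^ m * (y * (twistCoeff s r + s ^ (2 * r + 1)))

/-- From position `2` on, a row of the Burau matrix involves only the preceding and the last
position. All intermediate unknowns are therefore recursively expressed by the first and the last,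
leaving a determinant of size two. The factor `y - 1` reflects that the Burau rows sum to `1`. -/
theorem associated_det_burau_braidB (y s : R) (m r : ℕ) :
    Associated (y • burau s (braidB (r + 1) (m + 2)) - 1).det
      ((y - 1) * reducedDet y s m r) := by
  set b := twistCoeff s r + s ^ (2 * r + 1) with hb
  set G : ℕ → R := fun k => ∑ i ∈ Finset.range k, (y * s) ^ i with hG
  set A := y • burau s (braidB (r + 1) (m + 2)) - 1 with hA
  let f : Fin 2 → Fin (m + 2) := ![0, Fin.last (m + 1)]
  -- `H k` is the value that row `k + 1` prescribes. Row `1` gives `H 0`, and the later rows give `H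
  -- (k + 1) = y * s * H k + y * (1 - s) * (0, 1)`.
  let H : ℕ → Fin 2 → R := fun k => ![(y * s) ^ k * (y * b), (y * s) ^ k * (y * (1 - b)) +
    (y - y * s) * G k]
  let V : Matrix (Fin (m + 2)) (Fin 2) R := fun j =>
    if j.1 = 0 then ![1, 0] else if j.1 = m + 1 then ![0, 1] else H (j - 1)
  have hsum : ∀ (j : Fin (m + 2)) (k : Fin 2), (A * V) j k =
      y * ∑ i, burau s (braidB (r + 1) (m + 2)) j i * V i k - V j k := by
    intro j k
    rw [hA, Matrix.sub_mul, Matrix.one_mul, Matrix.smul_mul]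
    rfl
  have hV0 : V 0 = ![1, 0] := if_pos rfl
  have hVl : V (Fin.last (m + 1)) = ![0, 1] := by simp [V]
  have s0 : ∀ k, ∑ i : Fin (m + 2), (if i.1 = 0 then 1 else 0) * V i k = V 0 k := by
    intro k
    rw [Finset.sum_eq_single 0]
    · simp
    · intro i _ hi
      rw [if_neg (show i.1 ≠ 0 from fun h => hi (Fin.ext h)), zero_mul]
    · simp
  have sl : ∀ k, ∑ i : Fin (m + 2), (if i.1 = m + 1 then 1 else 0) * V i k =
      V (Fin.last (m + 1)) k := by
    intro k
    rw [Finset.sum_eq_single (Fin.last (m + 1))]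
    · simp
    · intro i _ hi
      rw [if_neg (show i.1 ≠ m + 1 from fun h => hi (Fin.ext h)), zero_mul]
    · simp
  have row0 : ∀ k, (A * V) 0 k =
      y * (![twistCoeff s r, 1 - twistCoeff s r] k) - ![1, 0] k := by
    intro k
    rw [hsum]
    simp only [burau_braidB, Fin.val_zero, if_pos, add_mul, mul_assoc, Finset.sum_add_distrib,
      ← Finset.mul_sum, s0, sl, hV0, hVl]
    fin_cases k <;> simp
  have row : ∀ (j : Fin (m + 2)) (k : Fin 2), j.1 ≠ 0 → (A * V) j k = H (j - 1) k - V j k := by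
    intro j k hj
    rw [hsum]
    congr 1
    by_cases hj1 : j.1 = 1
    · simp only [burau_braidB, hj1, if_neg one_ne_zero, if_pos, add_mul, mul_assoc,
        Finset.sum_add_distrib, ← Finset.mul_sum, s0, sl, hV0, hVl]
      fin_cases k <;> simp [H, G, b]
      ring
    · have hp : ∀ k, ∑ i : Fin (m + 2), (if i.1 + 1 = j.1 then 1 else 0) * V i k =
          H (j - 2) k := by
        intro k
        rw [Finset.sum_eq_single ⟨j - 1, by omega⟩]
        · rw [if_pos (by simp; omega), one_mul]
          simp only [V]
          rw [if_neg (by omega), if_neg (by omega), show j.1 - 1 - 1 = j.1 - 2 by omega]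
        · intro i _ hi
          rw [if_neg (fun h => hi (Fin.ext (by simp; omega))), zero_mul]
        · simp
      simp only [burau_braidB, if_neg hj, if_neg hj1, add_mul, mul_assoc,
        Finset.sum_add_distrib, ← Finset.mul_sum, hp, sl, hVl]
      obtain ⟨k', hk'⟩ : ∃ k', j.1 = k' + 2 := ⟨j - 2, by omega⟩
      rw [hk', Nat.add_sub_cancel, show k' + 2 - 1 = k' + 1 by omega]
      have hGs : G (k' + 1) = y * s * G k' + 1 := geom_sum_succ
      fin_cases k
      · simp [H]
        ring
      · simp [H, hGs]
        ring
  have hrange : ∀ j : Fin (m + 2), j ∉ Set.range f ↔ j.1 ≠ 0 ∧ j.1 ≠ m + 1 := by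
    intro j
    constructor
    · intro h
      exact ⟨fun h0 => h ⟨0, Fin.ext h0.symm⟩, fun h1 => h ⟨1, Fin.ext h1.symm⟩⟩
    · rintro ⟨h0, h1⟩ ⟨a, rfl⟩
      fin_cases a
      · exact h0 rfl
      · exact h1 rfl
  have key := det_of_elimination A f ?_ V Fin.val ?_ ?_ ?_ ?_
  · convert key using 1
    rw [Matrix.det_fin_two]
    have hgeom : G m * (y * s - 1) = (y * s) ^ m - 1 := geom_sum_mul _ _
    simp only [Matrix.submatrix_apply, f, id, Matrix.cons_val_zero, Matrix.cons_val_one]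
    rw [row0, row0, row _ _ (by simp), row _ _ (by simp), hVl, Fin.val_last, Nat.add_sub_cancel]
    simp [H, reducedDet]
    rw [← hb]
    change _ * ((y * twistCoeff s r - 1) * (1 + y * s * G m) - _) = _
    linear_combination ((y * twistCoeff s r - 1) * y) * hgeom
  · intro a c h
    fin_cases a <;> fin_cases c <;> simp [f, Fin.ext_iff] at h ⊢
  · ext a c
    fin_cases a <;> fin_cases c <;> simp [f, hV0, hVl]
  · intro j hj
    rw [hrange] at hj
    simp [hA, burau_braidB, hj]
  · intro j hj j' hj' hne hle
    rw [hrange] at hj hj'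
    have : j'.1 + 1 ≠ j.1 := by omega
    simp [hA, burau_braidB, hj, hj', this, hne]
  · intro j hj
    rw [hrange] at hj
    funext k
    rw [row j k hj.1]
    simp only [V, if_neg hj.1, if_neg hj.2, sub_self]
    rfl

end BraidWord

/-! ### Divisibility in the Laurent ring -/

namespace LinkDiagram

variable (D : LinkDiagram)

theorem coe_variableUnit (c : D.Component) :
    (D.variableUnit c : D.LaurentRing) = AddMonoidAlgebra.single (Finsupp.single c 1) 1 := rfl

theorem variableUnit_pow (c : D.Component) (n : ℕ) :
    (D.variableUnit c : D.LaurentRing) ^ n =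
      AddMonoidAlgebra.single (Finsupp.single c (n : ℤ)) 1 := by
  rw [coe_variableUnit, AddMonoidAlgebra.single_pow, one_pow, Finsupp.smul_single, nsmul_one]

theorem variableUnit_sub_one_dvd (c : D.Component) (k : ℤ) :
    (D.variableUnit c : D.LaurentRing) - 1 ∣
      AddMonoidAlgebra.single (Finsupp.single c k) 1 - 1 := by
  obtain ⟨n, rfl | rfl⟩ := k.eq_nat_or_neg
  · rw [← variableUnit_pow]
    simpa using sub_dvd_pow_sub_pow (D.variableUnit c : D.LaurentRing) 1 n
  · have h : AddMonoidAlgebra.single (Finsupp.single c (-(n : ℤ))) (1 : ℤ) *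
        (D.variableUnit c : D.LaurentRing) ^ n = 1 := by
      rw [variableUnit_pow, AddMonoidAlgebra.single_mul_single, ← Finsupp.single_add]
      simp [AddMonoidAlgebra.one_def]
    have h1 : (AddMonoidAlgebra.single (Finsupp.single c (-(n : ℤ))) 1 - 1 : D.LaurentRing) =
        -AddMonoidAlgebra.single (Finsupp.single c (-(n : ℤ))) (1 : ℤ) *
          ((D.variableUnit c : D.LaurentRing) ^ n - 1) := by
      linear_combination h
    rw [h1]
    refine Dvd.dvd.mul_left ?_ _
    simpa using sub_dvd_pow_sub_pow (D.variableUnit c : D.LaurentRing) 1 n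

/-- The ring homomorphism that sets the variable of one component to `1`. -/
def specialize (c : D.Component) : D.LaurentRing →+* D.LaurentRing :=
  AddMonoidAlgebra.mapDomainRingHom ℤ (Finsupp.eraseAddHom c)

theorem specialize_single (c : D.Component) (g : D.Component →₀ ℤ) (n : ℤ) :
    D.specialize c (AddMonoidAlgebra.single g n) = AddMonoidAlgebra.single (g.erase c) n :=
  AddMonoidAlgebra.mapDomain_single

theorem specialize_self (c : D.Component) :
    D.specialize c (D.variableUnit c : D.LaurentRing) = 1 := by
  rw [coe_variableUnit, specialize_single, Finsupp.erase_single]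
  rfl

theorem specialize_of_ne {c c' : D.Component} (h : c' ≠ c) :
    D.specialize c (D.variableUnit c' : D.LaurentRing) = D.variableUnit c' := by
  rw [coe_variableUnit, specialize_single, Finsupp.erase_single_ne h.symm]

theorem variableUnit_sub_one_dvd_sub_specialize (c : D.Component) (e : D.LaurentRing) :
    (D.variableUnit c : D.LaurentRing) - 1 ∣ e - D.specialize c e := by
  induction e using AddMonoidAlgebra.induction_linear with
  | zero => simp
  | add a b ha hb =>
    rw [map_add, add_sub_add_comm]
    exact dvd_add ha hb
  | single g n =>
    have h : (AddMonoidAlgebra.single g n : D.LaurentRing) =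
        AddMonoidAlgebra.single (g.erase c) n *
          AddMonoidAlgebra.single (Finsupp.single c (g c)) 1 := by
      rw [AddMonoidAlgebra.single_mul_single, Finsupp.erase_add_single, mul_one]
    rw [specialize_single, h, ← mul_sub_one]
    exact (D.variableUnit_sub_one_dvd c _).mul_left _

theorem variableUnit_ne_one (c : D.Component) : (D.variableUnit c : D.LaurentRing) - 1 ≠ 0 := by
  rw [sub_ne_zero, coe_variableUnit, AddMonoidAlgebra.one_def]
  intro h
  have := (AddMonoidAlgebra.single_left_inj one_ne_zero).1 h
  simp at this

theorem one_add_variableUnit_ne_zero (c : D.Component) :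
    1 + (D.variableUnit c : D.LaurentRing) ≠ 0 := by
  intro h
  have h2 := congrArg (D.specialize c) h
  rw [map_add, map_one, specialize_self, map_zero, AddMonoidAlgebra.one_def, ← AddMonoidAlgebra.single_add,
    AddMonoidAlgebra.single_eq_zero] at h2
  exact two_ne_zero h2

theorem one_sub_variableUnit_mul_ne_zero {c c' : D.Component} (h : c' ≠ c) :
    1 - (D.variableUnit c : D.LaurentRing) * D.variableUnit c' ≠ 0 := by
  intro h0
  have h2 := congrArg (D.specialize c) h0
  rw [map_sub, map_mul, map_one, specialize_self, specialize_of_ne D h, map_zero, one_mul] at h2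
  exact D.variableUnit_ne_one c' (by linear_combination -h2)

/-- If `e` and `f` are the two cofactors, then `(c' - 1) * e = (c - 1) * f` for the variables.
Setting the variable of `c` to `1` kills `e`, so `c - 1` divides `e` and cancels. -/
theorem dvd_of_dvd_variableUnit_sub_one_mul {c c' : D.Component} (h : c' ≠ c)
    (a b : D.LaurentRing) (h₁ : a ∣ (D.variableUnit c - 1) * b)
    (h₂ : a ∣ (D.variableUnit c' - 1) * b) : a ∣ b := by
  obtain ⟨e, he⟩ := h₁
  obtain ⟨f, hf⟩ := h₂
  by_cases ha : a = 0
  · subst ha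
    rw [zero_mul] at he
    rw [(mul_eq_zero.1 he).resolve_left (D.variableUnit_ne_one c)]
  · have hef : (D.variableUnit c' - 1) * e = ((D.variableUnit c : D.LaurentRing) - 1) * f :=
      mul_left_cancel₀ ha (by
        linear_combination ((D.variableUnit c : D.LaurentRing) - 1) * hf -
          ((D.variableUnit c' : D.LaurentRing) - 1) * he)
    have h0 := congrArg (D.specialize c) hef
    rw [map_mul, map_mul, map_sub, map_sub, map_one, specialize_self, specialize_of_ne D h,
      sub_self, zero_mul] at h0
    have hdvd := D.variableUnit_sub_one_dvd_sub_specialize c e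
    rw [(mul_eq_zero.1 h0).resolve_left (D.variableUnit_ne_one c'), sub_zero] at hdvd
    obtain ⟨g, rfl⟩ := hdvd
    exact ⟨g, mul_left_cancel₀ (D.variableUnit_ne_one c) (by linear_combination he)⟩

end LinkDiagram

/-! ### The components of the link -/

namespace BraidWord

/-- The permutation of the positions effected by a braid word. -/
def strandPerm {n : ℕ} : BraidWord n → Equiv.Perm (Fin n)
  | [] => 1
  | l :: w => strandPerm w * Equiv.swap (left l.1) (right l.1)

theorem strandPerm_append {n : ℕ} (u v : BraidWord n) :
    strandPerm (u ++ v) = strandPerm v * strandPerm u := by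
  induction u with
  | nil => simp [strandPerm]
  | cons l u ih =>
    change strandPerm (u ++ v) * _ = strandPerm v * (strandPerm u * _)
    rw [ih, mul_assoc]

theorem strandPerm_descending (m c : ℕ) (hc : c ≤ m) (j : Fin (m + 2)) :
    (strandPerm (n := m + 2)
      (((List.finRange m).drop c).reverse.map fun i => (i.succ, 1)) j : ℕ) =
      if j.1 ≤ c then j.1 else if j.1 = m + 1 then c + 1 else j.1 + 1 := by
  induction hc using Nat.decreasingInduction generalizing j with
  | self =>
    rw [List.drop_eq_nil_of_le (by simp)]
    change j.1 = _
    split_ifs <;> omega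
  | of_succ c hc ih =>
    rw [drop_finRange hc, List.reverse_cons, List.map_append, List.map_singleton,
      strandPerm_append]
    change (Equiv.swap _ _ _ : Fin (m + 2)).1 = _
    rw [Equiv.swap_apply_def]
    have h := ih j
    have := j.2
    generalize strandPerm (n := m + 2) _ j = v at h ⊢
    simp only [Fin.ext_iff, left, right, Fin.val_succ]
    split_ifs at h ⊢ <;> first | omega | (simp only <;> omega)

theorem strandPerm_replicate (m r : ℕ) :
    strandPerm (n := m + 2) (List.replicate (2 * r + 1) ((0 : Fin (m + 1)), (1 : ℤˣ))) =
      Equiv.swap 0 1 := by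
  induction r with
  | zero => exact one_mul _
  | succ r ih =>
    change (strandPerm (n := m + 2) (List.replicate (2 * r + 1) ((0 : Fin (m + 1)), (1 : ℤˣ))) *
      Equiv.swap 0 1) * Equiv.swap 0 1 = _
    rw [ih]
    simp

/-- The descending word fixes `0`, sends the last position to `1` and shifts the others up; the odd
power of the first generator then exchanges `0` and `1`. The outcome is a full cycle. -/
theorem strandPerm_braidB (m r : ℕ) (j : ℕ) (hj : j < m + 1) :
    strandPerm (braidB (r + 1) (m + 2)) ⟨j, by omega⟩ = ⟨j + 1, by omega⟩ := by
  have h := strandPerm_descending m 0 (Nat.zero_le m) ⟨j, by omega⟩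
  rw [List.drop_zero] at h
  rw [braidB_eq, strandPerm_append, show 2 * (r + 1) - 1 = 2 * r + 1 by omega,
    strandPerm_replicate, Equiv.Perm.mul_apply, Equiv.swap_apply_def]
  generalize strandPerm (n := m + 2) _ ⟨j, _⟩ = v at h ⊢
  dsimp only at h
  simp only [Fin.ext_iff, Fin.val_zero, Fin.val_one]
  split_ifs at h ⊢ <;> first | omega | (simp only [Fin.val_one]; omega)

variable {n : ℕ} (w : BraidWord n)

theorem component_strandSite (k : ℕ) (hk : k ≤ w.length) (j : Fin n) :
    w.closureWithAxis.component (w.strandSite ⟨k, by omega⟩ j) =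
      w.closureWithAxis.component
        (w.strandSite (Fin.natAdd w.length 0) (strandPerm (w.drop k) j)) := by
  induction hk using Nat.decreasingInduction generalizing j with
  | self => rw [List.drop_length]; rfl
  | of_succ k hk ih =>
    have h := w.next_symm_strandSite_succ k (by omega) (w.layerPerm ⟨k, by omega⟩ j)
    rw [Equiv.symm_apply_apply] at h
    rw [← h, LinkDiagram.component_next_symm, ih, List.drop_eq_getElem_cons hk, strandPerm]
    erw [w.layerPerm_castAdd ⟨k, hk⟩]
    rfl

theorem component_strandSite_last (j : Fin n) :
    w.closureWithAxis.component (w.strandSite (Fin.natAdd w.length 1) j) =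
      w.closureWithAxis.component (w.strandSite (Fin.natAdd w.length 0) j) := by
  have h := w.next_symm_strandSite_succ w.length (by omega) j
  erw [w.layerPerm_natAdd 0] at h
  exact (w.closureWithAxis.component_next_symm _).symm.trans (congrArg _ h)

theorem component_strandSite_strandPerm (j : Fin n) :
    w.closureWithAxis.component (w.strandSite (Fin.natAdd w.length 0) (strandPerm w j)) =
      w.closureWithAxis.component (w.strandSite (Fin.natAdd w.length 0) j) := by
  have h := w.component_strandSite 0 (Nat.zero_le _) j
  rw [List.drop_zero] at h
  rw [← h, ← component_strandSite_last, ← next_symm_strandSite_zero,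
    LinkDiagram.component_next_symm]
  rfl

theorem component_axisSite (hn : 0 < n) (a : Fin (n + n)) :
    w.closureWithAxis.component (w.axisSite a) = w.axisComponent hn := by
  obtain ⟨a, ha⟩ := a
  induction a with
  | zero => rfl
  | succ a ih =>
    rw [← LinkDiagram.component_next_symm, next_symm_axisSite_succ, ih]

/-- `next` acts on strand sites and axis sites separately, hence so do its powers. -/
theorem component_strandSite_ne (hn : 0 < n) (k : Fin (w.length + 2)) (j : Fin n) :
    w.axisComponent hn ≠ w.closureWithAxis.component (w.strandSite k j) := by
  intro h
  obtain ⟨z, hz⟩ := Quotient.exact h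
  have hz' : (Equiv.Perm.sumCongrHom _ _ (w.strandNext, finRotate (n + n)) ^ z)
      (Sum.inr (⟨0, by omega⟩ : Fin (n + n))) = Sum.inl (k, j) := hz
  rw [← map_zpow] at hz'
  cases hz'

theorem component_strandSite_braidB (m r : ℕ)
    (k : Fin ((braidB (r + 1) (m + 2)).length + 2)) (j : Fin (m + 2)) :
    (braidB (r + 1) (m + 2)).closureWithAxis.component
      ((braidB (r + 1) (m + 2)).strandSite k j) =
      (braidB (r + 1) (m + 2)).braidComponent (Nat.succ_pos _) := by
  set w := braidB (r + 1) (m + 2)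
  have h0 : ∀ j : Fin (m + 2),
      w.closureWithAxis.component (w.strandSite (Fin.natAdd w.length 0) j) =
        w.closureWithAxis.component (w.strandSite (Fin.natAdd w.length 0) 0) := by
    rintro ⟨j, hj⟩
    induction j with
    | zero => rfl
    | succ j ih =>
      rw [← ih (by omega), ← w.component_strandSite_strandPerm ⟨j, _⟩,
        strandPerm_braidB m r j (by omega)]
  have h1 : ∀ (k : Fin (w.length + 2)) (j : Fin (m + 2)),
      w.closureWithAxis.component (w.strandSite k j) =
        w.closureWithAxis.component (w.strandSite (Fin.natAdd w.length 0) 0) := by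
    intro k j
    by_cases hk : k.1 ≤ w.length
    · exact (w.component_strandSite k.1 hk j).trans (h0 _)
    · obtain rfl : k = Fin.natAdd w.length 1 := Fin.ext (by simp; omega)
      rw [component_strandSite_last, h0]
  rw [h1]
  exact (h1 0 0).symm

end BraidWord

/-! ### The closed formula -/

namespace BraidWord

section Polynomial

variable {R : Type} [CommRing R]

/-- The Alexander polynomial of `linkL (r + 1) (m + 2)`, without denominators. -/
def alexanderL (x t : R) (m r : ℕ) : R :=
  1 + x ^ (m + 1) * t ^ (m + 2 * r + 1) +
    x * (t - twistCoeff t r) * ∑ i ∈ Finset.range m, (x * t) ^ i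

theorem pow_mul_sub_twistCoeff {s t : R} (h : s * t = 1) (r : ℕ) :
    t ^ (2 * r + 2) * (s - twistCoeff s r) = t - twistCoeff t r := by
  induction r with
  | zero =>
    simp [twistCoeff]
    linear_combination t * h
  | succ r ih =>
    have h1 := one_add_mul_sub_twistCoeff t r
    have h2 : s ^ (2 * r + 1) * t ^ (2 * r + 1) = 1 := by rw [← mul_pow, h, one_pow]
    rw [twistCoeff_succ, twistCoeff_succ]
    have e1 : t ^ (2 * (r + 1) + 2) * (s - (twistCoeff s r + (1 - s) * s ^ (2 * r + 1))) =
        t ^ 2 * (t ^ (2 * r + 2) * (s - twistCoeff s r)) -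
          (t ^ 3 - t ^ 2 * (s * t)) * (s ^ (2 * r + 1) * t ^ (2 * r + 1)) := by ring
    rw [e1, ih, h2, h]
    linear_combination (t - 1) * h1

theorem pow_mul_geom_sum {u v : R} (h : u * v = 1) (m : ℕ) :
    v ^ m * (u * ∑ i ∈ Finset.range m, u ^ i) = ∑ i ∈ Finset.range m, v ^ i := by
  induction m with
  | zero => simp
  | succ m ih =>
    have h2 : u ^ (m + 1) * v ^ (m + 1) = 1 := by rw [← mul_pow, h, one_pow]
    rw [Finset.sum_range_succ, geom_sum_succ (x := v), ← ih]
    linear_combination h2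

/-- By `hE`, `-reducedDet y s m r` is the expression `alexanderL` in the inverse variables. That
expression is symmetric under inverting both variables, up to a monomial, because its geometric sum
and its `twistCoeff` factor are. -/
theorem alexanderL_eq_mul_reducedDet {x y s t : R} (hxy : y * x = 1) (hst : s * t = 1)
    (m r : ℕ) :
    alexanderL x t m r = -(x ^ (m + 1) * t ^ (m + 2 * r + 1)) * reducedDet y s m r := by
  have hu : (y * s) * (x * t) = 1 := by linear_combination s * t * hxy + hst
  have h1 := pow_mul_sub_twistCoeff hst r
  have h2 := pow_mul_geom_sum hu m
  have h3 : (y * s) ^ m * (x * t) ^ m = 1 := by rw [← mul_pow, hu, one_pow]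
  have h4 : s ^ (2 * r + 1) * t ^ (2 * r + 1) = 1 := by rw [← mul_pow, hst, one_pow]
  have h5 : (∑ i ∈ Finset.range m, (y * s) ^ i) * (y * s - 1) = (y * s) ^ m - 1 :=
    geom_sum_mul _ _
  have hE : -reducedDet y s m r = 1 + (y * s) ^ m * y * s ^ (2 * r + 1) +
      y * (s - twistCoeff s r) * ∑ i ∈ Finset.range m, (y * s) ^ i := by
    rw [reducedDet]
    linear_combination (-(y * twistCoeff s r)) * h5
  rw [neg_mul, ← mul_neg, hE, alexanderL, ← h1, ← h2]
  generalize (∑ i ∈ Finset.range m, (y * s) ^ i) = G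
  generalize s - twistCoeff s r = c
  have e1 : x ^ (m + 1) * t ^ (m + 2 * r + 1) *
      (1 + (y * s) ^ m * y * s ^ (2 * r + 1) + y * c * G) =
      x ^ (m + 1) * t ^ (m + 2 * r + 1) +
        ((y * s) ^ m * (x * t) ^ m) * (y * x) * (s ^ (2 * r + 1) * t ^ (2 * r + 1)) +
        (x * t) ^ m * t ^ (2 * r + 1) * (y * x) * c * G := by ring
  have e2 : x * (t ^ (2 * r + 2) * c) * ((x * t) ^ m * (y * s * G)) =
      (x * t) ^ m * t ^ (2 * r + 1) * (y * x) * (s * t) * c * G := by ring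
  rw [e1, e2, h3, hxy, h4, hst]
  ring

/-- The exponent `2 * r - 1` is an integer power since it is `-1` at `r = 0`; the factor `t ^ 2`
absorbs it. -/
theorem alexanderL_eq_div {K : Type} [Field K] (x t : K) (ht : t ≠ 0) (h1 : 1 + t ≠ 0)
    (h2 : 1 - x * t ≠ 0) (m r : ℕ) :
    alexanderL x t m r = 1 + x ^ (m + 1) * t ^ (m + 2 * r + 1) +
      x * t ^ 2 * ((1 + t ^ (2 * (r : ℤ) - 1)) / (1 + t)) * ((1 - (x * t) ^ m) / (1 - x * t)) := by
  have hg : (∑ i ∈ Finset.range m, (x * t) ^ i) = (1 - (x * t) ^ m) / (1 - x * t) := by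
    rw [eq_div_iff h2]
    linear_combination -(geom_sum_mul (x * t) m)
  have hz : t ^ 2 * t ^ (2 * (r : ℤ) - 1) = t ^ (2 * r + 1) := by
    rw [← zpow_natCast, ← zpow_natCast, ← zpow_add₀ ht]
    congr 1
    push_cast
    ring
  have hc : t - twistCoeff t r = t ^ 2 * ((1 + t ^ (2 * (r : ℤ) - 1)) / (1 + t)) := by
    rw [← mul_div_assoc, eq_div_iff h1]
    linear_combination one_add_mul_sub_twistCoeff t r - hz
  rw [alexanderL, hg, hc]
  ring

theorem map_alexanderL {S : Type} [CommRing S] (f : R →+* S) (x t : R) (m r : ℕ) :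
    f (alexanderL x t m r) = alexanderL (f x) (f t) m r := by
  simp [alexanderL, twistCoeff]

end Polynomial

theorem isAlexanderPolynomial_alexanderL (m r : ℕ) (hq : 2 ≤ m + 2) :
    (linkL (r + 1) (m + 2)).IsAlexanderPolynomial
      (alexanderL (linkL.x (r + 1) (m + 2) hq) (linkL.t (r + 1) (m + 2) hq) m r) := by
  set w := braidB (r + 1) (m + 2)
  have hn : 0 < m + 2 := Nat.succ_pos _
  set x := w.closureWithAxis.variableUnit (w.axisComponent hn)
  set t := w.closureWithAxis.variableUnit (w.braidComponent hn)
  have hne : w.braidComponent hn ≠ w.axisComponent hn := (w.component_strandSite_ne hn _ _).symm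
  have hx : ∀ a, w.closureWithAxis.variableUnit (w.closureWithAxis.component (w.axisSite a)) = x :=
    fun a => by rw [w.component_axisSite hn]
  have ht : ∀ k j,
      w.closureWithAxis.variableUnit (w.closureWithAxis.component (w.strandSite k j)) = t :=
    fun k j => by rw [component_strandSite_braidB]
  have hw : ∀ l ∈ w, l.2 = 1 := fun l hl => snd_of_mem_braidB hl
  have hxx : ((x⁻¹ : w.closureWithAxis.LaurentRingˣ) : w.closureWithAxis.LaurentRing) * x = 1 := by
    simp
  have htt : ((t⁻¹ : w.closureWithAxis.LaurentRingˣ) : w.closureWithAxis.LaurentRing) * t = 1 := by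
    simp
  obtain ⟨u, hu⟩ := associated_det_burau_braidB
    ((x⁻¹ : w.closureWithAxis.LaurentRingˣ) : w.closureWithAxis.LaurentRing)
    ((t⁻¹ : w.closureWithAxis.LaurentRingˣ) : w.closureWithAxis.LaurentRing) m r
  have hΔ := alexanderL_eq_mul_reducedDet hxx htt m r
  set Δ := alexanderL (x : w.closureWithAxis.LaurentRing) t m r
  set E := reducedDet
    ((x⁻¹ : w.closureWithAxis.LaurentRingˣ) : w.closureWithAxis.LaurentRing)
    ((t⁻¹ : w.closureWithAxis.LaurentRingˣ) : w.closureWithAxis.LaurentRing) m r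
  have hassoc : Associated E Δ := ⟨-(x ^ (m + 1) * t ^ (m + 2 * r + 1)), by
    rw [hΔ]
    push_cast
    ring⟩
  have hu' : ((u⁻¹ : w.closureWithAxis.LaurentRingˣ) : w.closureWithAxis.LaurentRing) * u = 1 := by
    simp
  -- The determinant is `(x⁻¹ - 1) * E` up to the unit `u`, and `x⁻¹ - 1 = -x⁻¹ * (x - 1)`; this
  -- gives the factor beside `E`.
  have hD := w.dvd_adjugate_reducedMatrix_iff x t hn hw
    (w.closureWithAxis.variableUnit_ne_one _)
    (w.closureWithAxis.dvd_of_dvd_variableUnit_sub_one_mul hne)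
    (E * ((-(x⁻¹ * u⁻¹) : w.closureWithAxis.LaurentRingˣ) : w.closureWithAxis.LaurentRing)) (by
      push_cast
      generalize Matrix.det (n := Fin (m + 2)) (R := w.closureWithAxis.LaurentRing) _ = d at hu ⊢
      linear_combination (-d) * hu' + (u⁻¹ : w.closureWithAxis.LaurentRingˣ) * hu +
        (u⁻¹ : w.closureWithAxis.LaurentRingˣ) * E * hxx)
  have : Nonempty w.closureWithAxis.Site := ⟨w.strandSite 0 0⟩
  refine (w.closureWithAxis.isAlexanderPolynomial_iff Δ).2 fun d => ?_
  rw [w.dvd_adjugate_iff_reducedMatrix hx ht hn hw, hD, ← hassoc.dvd_iff_dvd_right,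
    Units.dvd_mul_right]

end BraidWord

/-! ### The main theorem -/

theorem lemma3p1 (p q : ℕ) (hp : 1 ≤ p) (hq : 2 ≤ q) :
    -- the link has exactly two components, the axis and the closed braid
    ((braidB p q).axisComponent (by omega) ≠ (braidB p q).braidComponent (by omega) ∧
      ∀ c : (linkL p q).Component,
        c = (braidB p q).axisComponent (by omega) ∨ c = (braidB p q).braidComponent (by omega)) ∧
    -- its Alexander polynomial, as an element of the field of fractions
    ∃ Δ : (linkL p q).LaurentRing, (linkL p q).IsAlexanderPolynomial Δ ∧
      ∀ x t : (linkL p q).RationalFunctions,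
        x = algebraMap _ _ (linkL.x p q hq) → t = algebraMap _ _ (linkL.t p q hq) →
        (q = 2 → algebraMap _ (linkL p q).RationalFunctions Δ = 1 + x * t ^ (2 * p - 1)) ∧
        (3 ≤ q → algebraMap _ (linkL p q).RationalFunctions Δ =
          1 + x ^ (q - 1) * t ^ (2 * p + q - 3) +
            x * t ^ 2 * ((1 + t ^ (2 * (p : ℤ) - 3)) / (1 + t)) *
              ((1 - (x * t) ^ (q - 2)) / (1 - x * t))) := by
  obtain ⟨r, rfl⟩ : ∃ r, p = r + 1 := ⟨p - 1, by omega⟩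
  obtain ⟨m, rfl⟩ : ∃ m, q = m + 2 := ⟨q - 2, by omega⟩
  have hn : 0 < m + 2 := Nat.succ_pos _
  have hne := (braidB (r + 1) (m + 2)).component_strandSite_ne hn 0 0
  rw [BraidWord.component_strandSite_braidB] at hne
  refine ⟨⟨hne, fun c => ?_⟩, _, BraidWord.isAlexanderPolynomial_alexanderL m r hq, ?_⟩
  · obtain ⟨s, rfl⟩ := Quotient.exists_rep c
    revert s
    refine (BraidWord.forall_site _).2 ⟨fun k j => Or.inr ?_, fun a => Or.inl ?_⟩
    · exact BraidWord.component_strandSite_braidB m r k j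
    · exact BraidWord.component_axisSite _ hn a
  · rintro x t hx ht
    have inj := IsFractionRing.injective (linkL (r + 1) (m + 2)).LaurentRing
      (linkL (r + 1) (m + 2)).RationalFunctions
    have ht0 : t ≠ 0 := by
      rw [ht]
      exact ((Units.isUnit _).map (algebraMap _ _)).ne_zero
    have h1 : 1 + t ≠ 0 := by
      have h : 1 + t = algebraMap _ _ (1 + linkL.t (r + 1) (m + 2) hq) := by
        rw [map_add, map_one, ht]
      rw [h]
      exact (map_ne_zero_iff _ inj).2 (LinkDiagram.one_add_variableUnit_ne_zero _ _)
    have h2 : 1 - x * t ≠ 0 := by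
      have h : 1 - x * t = algebraMap _ _
          (1 - linkL.x (r + 1) (m + 2) hq * linkL.t (r + 1) (m + 2) hq) := by
        rw [map_sub, map_mul, map_one, hx, ht]
      rw [h]
      exact (map_ne_zero_iff _ inj).2 (LinkDiagram.one_sub_variableUnit_mul_ne_zero _ hne.symm)
    rw [BraidWord.map_alexanderL, ← hx, ← ht]
    constructor
    · intro hm
      obtain rfl : m = 0 := by omega
      rw [BraidWord.alexanderL, show 2 * (r + 1) - 1 = 0 + 2 * r + 1 by omega]
      simp
    · intro _
      rw [BraidWord.alexanderL_eq_div x t ht0 h1 h2,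
        show 2 * (r + 1) + (m + 2) - 3 = m + 2 * r + 1 by omega,
        show 2 * ((r + 1 : ℕ) : ℤ) - 3 = 2 * (r : ℤ) - 1 by push_cast; ring]
      rfl

end
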